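/- Let $\mathbb{K}$ be a unital commutative ring. A Lie superalgebra over $\mathbb{K}$ is a $\mathbb{Z}/2$-graded $\mathbb{K}$-module $L=L_{\bar 0}\oplus L_{\bar 1}$ with an even bilinear bracket satisfying $[x,y]=-(-1)^{|x||y|}[y,x]$, $[x,[y,z]]=[[x,y],z]+(-1)^{|x||y|}[y,[x,z]]$ for homogeneous $x,y,z$, and $[x_0,x_0]=0$ for $x_0\in L_{\bar 0}$; homomorphisms are even linear maps preserving the bracket. Let $A=A_{\bar 0}\oplus A_{\bar 1}$ be a unital associative superalgebra over $\mathbb{K}$, and let $m,n\ge 0$ be integers with $m+n\ge 5$. Put $|i|=\bar 0$ for $1\le i\le m$ and $|i|=\bar 1$ for $m<i\le m+n$. Let $\mathfrak{gl}(m,n,A)$ be the Lie superalgebra of $(m+n)\times(m+n)$ matrices over $A$, with $|E_{ij}(a)|=|i|+|j|+|a|$ for homogeneous $a$ (where $E_{ij}(a)$ has entry $a$ at position $(i,j)$ and zeros elsewhere) and bracket determined by $[x,y]=xy-(-1)^{|x||y|}yx$ for homogeneous $x,y$. Let $\mathfrak{sl}(m,n,A)$ be its subalgebra generated by the $E_{ij}(a)$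 with $i\ne j$ and $a\in A$ homogeneous. Let $\mathfrak{st}(m,n,A)$ be the Lie superalgebra over $\mathbb{K}$ generated by homogeneous elements $F_{ij}(a)$, for $i\neq j$ and $a\in A$ homogeneous, of degree $|i|+|j|+|a|$, subject to the relations: $a\mapsto F_{ij}(a)$ is $\mathbb{K}$-linear; $[F_{ij}(a),F_{jk}(b)]=F_{ik}(ab)$ for distinct $i,j,k$; and $[F_{ij}(a),F_{kl}(b)]=0$ for $j\ne k$, $i\ne l$. Theorem. The Lie superalgebra $\mathfrak{sl}(m,n,A)$ is perfect, that is, spanned by its brackets. There is a unique homomorphism of Lie superalgebras $\mathfrak{st}(m,n,A)\to\mathfrak{sl}(m,n,A)$ with $F_{ij}(a)\mapsto E_{ij}(a)$ for all $i\neq j$ and all homogeneous $a\in A$, and it is the universal central extension of $\mathfrak{sl}(m,n,A)$: it is surjective with kernel contained in the centre of $\mathfrak{st}(m,n,A)$, and for every surjective homomorphism of Lie superalgebras $f\colon M\to\mathfrak{sl}(m,n,A)$ with $\ker f$ contained in the centre of $M$ there is exactly one homomorphism $\theta\colon\mathfrak{st}(m,n,A)\to M$ whose composite with $f$ is the given map.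 -/

import Mathlib

/-- The sign `(-1) ^ (i * j)` for degrees `i j : ZMod 2`. -/
def koszulSign (i j : ZMod 2) : ℤ := if i = 1 ∧ j = 1 then -1 else 1

/-- A Lie superalgebra over a commutative ring `K`, on the `K`-module `L`: a decomposition
`L = part 0 ⊕ part 1` and an even bilinear bracket which is super skew-symmetric, satisfies the
super Jacobi identity and vanishes on the squares of even elements. -/
class LieSuperalgebra (K : Type*) (L : Type*) [CommRing K] [AddCommGroup L] [Module K L] where
  part : ZMod 2 → Submodule K L
  isCompl_part : IsCompl (part 0) (part 1)
  bracket : L →ₗ[K] L →ₗ[K] L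
  bracket_mem : ∀ {i j : ZMod 2} {x y : L}, x ∈ part i → y ∈ part j → bracket x y ∈ part (i + j)
  bracket_skew : ∀ {i j : ZMod 2} {x y : L}, x ∈ part i → y ∈ part j →
    bracket x y = -(koszulSign i j • bracket y x)
  bracket_jacobi : ∀ {i j k : ZMod 2} {x y z : L}, x ∈ part i → y ∈ part j → z ∈ part k →
    bracket x (bracket y z) =
      bracket (bracket x y) z + koszulSign i j • bracket y (bracket x z)
  bracket_self : ∀ {x : L}, x ∈ part 0 → bracket x x = 0

namespace LieSuperalgebra

section Basic

variable (K : Type*) [CommRing K]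

/-- A homomorphism of Lie superalgebras: an even linear map preserving the bracket. -/
structure Hom (L M : Type*) [AddCommGroup L] [Module K L] [LieSuperalgebra K L]
    [AddCommGroup M] [Module K M] [LieSuperalgebra K M] where
  toLinearMap : L →ₗ[K] M
  map_part : ∀ (i : ZMod 2) (x : L), x ∈ part (K := K) i → toLinearMap x ∈ part (K := K) i
  map_bracket : ∀ x y : L, toLinearMap (bracket (K := K) x y) =
    bracket (K := K) (toLinearMap x) (toLinearMap y)

/-- `f : M → P` is a central extension of `P`: it is surjective, and its kernel lies in the
centre of `M`. -/
def IsCentralExtension {M P : Type*} [AddCommGroup M] [Module K M] [LieSuperalgebra K M]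
    [AddCommGroup P] [Module K P] [LieSuperalgebra K P] (f : Hom K M P) : Prop :=
  Function.Surjective f.toLinearMap ∧
    ∀ c : M, f.toLinearMap c = 0 → ∀ x : M, bracket (K := K) c x = 0

/-- `u : U → P` is a universal central extension (with respect to central extensions by Lie
superalgebras living in the universe `w`): every central extension of `P` receives a unique
homomorphism from `U` over `P`. -/
def IsUniversalCentralExtension.{w, k, a, b} {K : Type k} [CommRing K] {U : Type a} {P : Type b}
    [AddCommGroup U] [Module K U] [LieSuperalgebra K U]
    [AddCommGroup P] [Module K P] [LieSuperalgebra K P] (u : Hom K U P) : Prop :=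
  IsCentralExtension K u ∧
    ∀ (M : Type w) [AddCommGroup M] [Module K M] [LieSuperalgebra K M] (f : Hom K M P),
      IsCentralExtension K f →
        ∃! θ : Hom K U M, ∀ x : U, f.toLinearMap (θ.toLinearMap x) = u.toLinearMap x

/-- A Lie superalgebra is perfect if it is spanned by its brackets. -/
def IsPerfect (L : Type*) [AddCommGroup L] [Module K L] [LieSuperalgebra K L] : Prop :=
  Submodule.span K {z : L | ∃ x y : L, z = bracket (K := K) x y} = ⊤

end Basic

section Graded

theorem zmod_two_cases (i : ZMod 2) : i = 0 ∨ i = 1 := by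
  revert i
  decide

theorem zmod_two_univ : (Set.univ : Set (ZMod 2)) = {0, 1} := by
  ext i
  simpa using zmod_two_cases i

variable {K V : Type*} [CommRing K] [AddCommGroup V] [Module K V] {p : ZMod 2 → Submodule K V}

theorem le_graded {N : Submodule K V} (i : ZMod 2) {x : V} (hx : x ∈ N) (hi : x ∈ p i) :
    x ∈ (N ⊓ p 0) ⊔ (N ⊓ p 1) := by
  rcases zmod_two_cases i with rfl | rfl
  · exact Submodule.mem_sup_left ⟨hx, hi⟩
  · exact Submodule.mem_sup_right ⟨hx, hi⟩

theorem exists_add (h : IsCompl (p 0) (p 1)) (x : V) : ∃ y ∈ p 0, ∃ z ∈ p 1, y + z = x :=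
  Submodule.mem_sup.1 (h.sup_eq_top ▸ Submodule.mem_top)

theorem eq_zero_of_add (h : IsCompl (p 0) (p 1)) {y z : V} (hy : y ∈ p 0) (hz : z ∈ p 1)
    (e : y + z = 0) : y = 0 ∧ z = 0 := by
  have hyz : y = -z := eq_neg_of_add_eq_zero_left e
  have : y ∈ p 0 ⊓ p 1 := ⟨hy, hyz ▸ (p 1).neg_mem hz⟩
  rw [h.inf_eq_bot, Submodule.mem_bot] at this
  subst this
  simpa using e

/-- A graded submodule is the direct sum of its even and odd parts. -/
theorem isCompl_comap (h : IsCompl (p 0) (p 1)) {N : Submodule K V}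
    (hN : N ≤ (N ⊓ p 0) ⊔ (N ⊓ p 1)) :
    IsCompl ((p 0).comap N.subtype) ((p 1).comap N.subtype) := by
  constructor
  · rw [Submodule.disjoint_def]
    intro x h0 h1
    have : (x : V) ∈ p 0 ⊓ p 1 := ⟨h0, h1⟩
    rw [h.inf_eq_bot, Submodule.mem_bot] at this
    exact Subtype.ext this
  · rw [codisjoint_iff, eq_top_iff]
    rintro ⟨x, hx⟩ -
    obtain ⟨y, hy, z, hz, rfl⟩ := Submodule.mem_sup.1 (hN hx)
    exact Submodule.mem_sup.2 ⟨⟨y, hy.1⟩, hy.2, ⟨z, hz.1⟩, hz.2, rfl⟩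

/-- The quotient by a graded submodule is the direct sum of the images of the two parts. -/
theorem isCompl_map (h : IsCompl (p 0) (p 1)) {N : Submodule K V}
    (hN : N ≤ (N ⊓ p 0) ⊔ (N ⊓ p 1)) :
    IsCompl ((p 0).map N.mkQ) ((p 1).map N.mkQ) := by
  constructor
  · rw [Submodule.disjoint_def]
    rintro _ ⟨y, hy, rfl⟩ ⟨z, hz, e⟩
    have : y - z ∈ N := by
      rw [← Submodule.Quotient.mk_eq_zero, Submodule.Quotient.mk_sub, sub_eq_zero]
      exact e.symm
    obtain ⟨a, ha, b, hb, e'⟩ := Submodule.mem_sup.1 (hN this)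
    have := eq_zero_of_add h (Submodule.sub_mem _ ha.2 hy) (Submodule.add_mem _ hb.2 hz) (by
      have : a - y + (b + z) = (a + b) - (y - z) := by abel
      rw [this, e', sub_self])
    have hay : a = y := sub_eq_zero.1 this.1
    rw [← hay]
    exact (Submodule.Quotient.mk_eq_zero N).2 ha.1
  · rw [codisjoint_iff, ← Submodule.map_sup, h.sup_eq_top, Submodule.map_top,
      Submodule.range_mkQ]

end Graded

section Subalgebra

variable {K L : Type*} [CommRing K] [AddCommGroup L] [Module K L] [LieSuperalgebra K L]

/-- The subalgebra generated by a set: the smallest submodule which contains it and is closed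
under the bracket. -/
def subalgebraClosure (K : Type*) {L : Type*} [CommRing K] [AddCommGroup L] [Module K L]
    [LieSuperalgebra K L] (S : Set L) : Submodule K L :=
  sInf {N | S ⊆ N ∧ ∀ x ∈ N, ∀ y ∈ N, bracket (K := K) x y ∈ N}

theorem subset_subalgebraClosure (S : Set L) : S ⊆ subalgebraClosure K S := by
  intro x hx
  exact (Submodule.mem_sInf).2 fun N hN => hN.1 hx

theorem bracket_mem_subalgebraClosure (S : Set L) :
    ∀ x ∈ subalgebraClosure K S, ∀ y ∈ subalgebraClosure K S,
      bracket (K := K) x y ∈ subalgebraClosure K S := by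
  intro x hx y hy
  exact (Submodule.mem_sInf).2 fun N hN =>
    hN.2 x (Submodule.mem_sInf.1 hx N hN) y (Submodule.mem_sInf.1 hy N hN)

/-- A subalgebra generated by homogeneous elements is graded. -/
theorem subalgebraClosure_graded (S : Set L) (hS : ∀ x ∈ S, ∃ i, x ∈ part (K := K) i) :
    subalgebraClosure K S ≤
      (subalgebraClosure K S ⊓ part 0) ⊔ (subalgebraClosure K S ⊓ part 1) := by
  refine sInf_le ⟨?_, ?_⟩
  · intro x hx
    obtain ⟨i, hi⟩ := hS x hx
    exact le_graded i (subset_subalgebraClosure S hx) hi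
  · have key : ∀ i j (x y : L), x ∈ subalgebraClosure K S ⊓ part i →
        y ∈ subalgebraClosure K S ⊓ part j → bracket (K := K) x y ∈
          (subalgebraClosure K S ⊓ part 0) ⊔ (subalgebraClosure K S ⊓ part 1) :=
      fun i j x y hx hy => le_graded (i + j)
        (bracket_mem_subalgebraClosure S x hx.1 y hy.1) (bracket_mem hx.2 hy.2)
    intro x hx y hy
    obtain ⟨x0, hx0, x1, hx1, rfl⟩ := Submodule.mem_sup.1 hx
    obtain ⟨y0, hy0, y1, hy1, rfl⟩ := Submodule.mem_sup.1 hy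
    simp only [map_add, LinearMap.add_apply]
    exact add_mem (add_mem (key _ _ _ _ hx0 hy0) (key _ _ _ _ hx1 hy0))
      (add_mem (key _ _ _ _ hx0 hy1) (key _ _ _ _ hx1 hy1))

/-- The induced Lie superalgebra structure on a graded submodule closed under the bracket. -/
@[reducible] def restrict (N : Submodule K L)
    (hN : ∀ x ∈ N, ∀ y ∈ N, bracket (K := K) x y ∈ N)
    (hgr : N ≤ (N ⊓ part 0) ⊔ (N ⊓ part 1)) : LieSuperalgebra K N where
  part i := (part i).comap N.subtype
  isCompl_part := isCompl_comap isCompl_part hgr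
  bracket := LinearMap.mk₂ K (fun x y => ⟨bracket (K := K) (x : L) (y : L), hN x x.2 y y.2⟩)
    (fun x x' y => Subtype.ext (by simp)) (fun c x y => Subtype.ext (by simp))
    (fun x y y' => Subtype.ext (by simp)) (fun c x y => Subtype.ext (by simp))
  bracket_mem hx hy := bracket_mem (K := K) (L := L) hx hy
  bracket_skew {i j x y} hx hy := Subtype.ext (by
    simpa using bracket_skew (K := K) (L := L) hx hy)
  bracket_jacobi hx hy hz := Subtype.ext (by
    simpa using bracket_jacobi (K := K) (L := L) hx hy hz)
  bracket_self hx := Subtype.ext (by simpa using bracket_self (K := K) (L := L) hx)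

end Subalgebra

section Associative

variable {K B : Type*} [CommRing K] [Ring B] [Algebra K B] (ℬ : ZMod 2 → Submodule K B)
  [GradedAlgebra ℬ]

/-- The supercommutator: the bilinear map with `[x, y] = x y - (-1)^{|x||y|} y x` for homogeneous
`x`, `y`. -/
noncomputable def superCommutator : B →ₗ[K] B →ₗ[K] B :=
  LinearMap.mul K B - ∑ i : ZMod 2, ∑ j : ZMod 2,
    koszulSign i j • ((LinearMap.mul K B).flip.compl₁₂ (GradedAlgebra.proj ℬ i)
      (GradedAlgebra.proj ℬ j))

theorem superCommutator_apply {i j : ZMod 2} {x y : B} (hx : x ∈ ℬ i) (hy : y ∈ ℬ j) :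
    superCommutator ℬ x y = x * y - koszulSign i j • (y * x) := by
  have hp : ∀ k, GradedAlgebra.proj ℬ k x = if k = i then x else 0 := by
    intro k
    rw [GradedAlgebra.proj_apply, DirectSum.decompose_of_mem _ hx, DirectSum.coe_of_apply]
    by_cases h : k = i
    · subst h; simp
    · rw [if_neg h, if_neg (fun e => h e.symm), ZeroMemClass.coe_zero]
  have hq : ∀ k, GradedAlgebra.proj ℬ k y = if k = j then y else 0 := by
    intro k
    rw [GradedAlgebra.proj_apply, DirectSum.decompose_of_mem _ hy, DirectSum.coe_of_apply]
    by_cases h : k = j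
    · subst h; simp
    · rw [if_neg h, if_neg (fun e => h e.symm), ZeroMemClass.coe_zero]
  simp [superCommutator, LinearMap.sum_apply, hp, hq]

/-- An associative superalgebra, regarded as a Lie superalgebra by means of the
supercommutator. -/
@[reducible] noncomputable def ofAssociative : LieSuperalgebra K B where
  part := ℬ
  isCompl_part := (DirectSum.isInternal_submodule_iff_isCompl ℬ (i := 0) (j := 1) (by decide) zmod_two_univ).1 (DirectSum.Decomposition.isInternal ℬ)
  bracket := superCommutator ℬ
  bracket_mem {i j x y} hx hy := by
    rw [superCommutator_apply ℬ hx hy]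
    have h := SetLike.mul_mem_graded hy hx
    rw [add_comm j i] at h
    exact sub_mem (SetLike.mul_mem_graded hx hy) (zsmul_mem h _)
  bracket_skew {i j x y} hx hy := by
    rw [superCommutator_apply ℬ hx hy, superCommutator_apply ℬ hy hx]
    rcases zmod_two_cases i with rfl | rfl <;> rcases zmod_two_cases j with rfl | rfl <;>
      simp [koszulSign]
  bracket_jacobi {i j k x y z} hx hy hz := by
    have hm : ∀ {a b : ZMod 2} {u v : B}, u ∈ ℬ a → v ∈ ℬ b → superCommutator ℬ u v ∈ ℬ (a + b) := by
      intro a b u v hu hv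
      rw [superCommutator_apply ℬ hu hv]
      have h := SetLike.mul_mem_graded hv hu
      rw [add_comm b a] at h
      exact sub_mem (SetLike.mul_mem_graded hu hv) (zsmul_mem h _)
    rw [superCommutator_apply ℬ hx (hm hy hz), superCommutator_apply ℬ (hm hx hy) hz,
      superCommutator_apply ℬ hy (hm hx hz), superCommutator_apply ℬ hy hz,
      superCommutator_apply ℬ hx hy, superCommutator_apply ℬ hx hz]
    have e : (1 + 1 : ZMod 2) = 0 := rfl
    rcases zmod_two_cases i with rfl | rfl <;> rcases zmod_two_cases j with rfl | rfl <;>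
      rcases zmod_two_cases k with rfl | rfl <;> simp [koszulSign, e] <;> noncomm_ring
  bracket_self {x} hx := by
    rw [superCommutator_apply ℬ hx hx]
    simp [koszulSign]

end Associative

section Presentation

variable {X : Type*} (K : Type*) [CommRing K] (deg : X → ZMod 2)

/-- The degree of a nonassociative word in letters of given degrees. -/
def wordDegree : FreeMagma X → ZMod 2
  | .of x => deg x
  | .mul v w => wordDegree v + wordDegree w

/-- The homogeneous part of degree `i` of the free nonassociative algebra on a graded set. -/
noncomputable def freePart (i : ZMod 2) : Submodule K (FreeNonUnitalNonAssocAlgebra K X) :=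
  MonoidAlgebra.supported K K {w : FreeMagma X | wordDegree deg w = i}

theorem isCompl_freePart : IsCompl (freePart K deg 0) (freePart K deg 1) := by
  constructor
  · rw [Submodule.disjoint_def]
    intro t h0 h1
    rw [freePart, MonoidAlgebra.mem_supported'] at h0 h1
    refine MonoidAlgebra.coeffEquiv.injective (Finsupp.ext fun w => ?_)
    by_cases h : wordDegree deg w = 0
    · exact h1 w (by simp [h])
    · exact h0 w h
  · classical
    rw [codisjoint_iff, eq_top_iff]
    intro t _
    refine Submodule.mem_sup.2
      ⟨.ofCoeff (t.coeff.filter fun w => wordDegree deg w = 0), ?_,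
       .ofCoeff (t.coeff.filter fun w => ¬ wordDegree deg w = 0), ?_, ?_⟩
    · rw [freePart, MonoidAlgebra.mem_supported']
      intro w hw
      exact Finsupp.filter_apply_neg _ _ hw
    · rw [freePart, MonoidAlgebra.mem_supported']
      intro w hw
      refine Finsupp.filter_apply_neg _ _ ?_
      have h2 : ∀ a : ZMod 2, ¬ a = 1 → ¬ ¬ a = 0 := by decide
      exact h2 _ hw
    · refine MonoidAlgebra.coeffEquiv.injective ?_
      exact Finsupp.filter_add_filter_not _ _

theorem mul_mem_freePart {i j : ZMod 2} {s t : FreeNonUnitalNonAssocAlgebra K X}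
    (hs : s ∈ freePart K deg i) (ht : t ∈ freePart K deg j) : s * t ∈ freePart K deg (i + j) := by
  classical
  rw [freePart, MonoidAlgebra.mem_supported] at *
  intro w hw
  obtain ⟨a, ha, b, hb, rfl⟩ := Finset.mem_mul.1 (MonoidAlgebra.support_coeff_mul_subset s t hw)
  have h1 : wordDegree deg a = i := hs ha
  have h2 : wordDegree deg b = j := ht hb
  change wordDegree deg a + wordDegree deg b = i + j
  rw [h1, h2]

theorem of_mem_freePart (x : X) :
    FreeNonUnitalNonAssocAlgebra.of K x ∈ freePart K deg (deg x) := by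
  rw [freePart, MonoidAlgebra.mem_supported]
  intro w hw
  have : w = FreeMagma.of x := Finset.mem_singleton.1 (Finsupp.support_single_subset hw)
  rw [this]
  rfl

/-- The elements of the free nonassociative algebra which express the defining identities of a
Lie superalgebra. -/
inductive LieRelator : FreeNonUnitalNonAssocAlgebra K X → Prop
  | skew {i j : ZMod 2} {x y : FreeNonUnitalNonAssocAlgebra K X} (hx : x ∈ freePart K deg i)
      (hy : y ∈ freePart K deg j) : LieRelator (x * y + koszulSign i j • (y * x))
  | jacobi {i j k : ZMod 2} {x y z : FreeNonUnitalNonAssocAlgebra K X}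
      (hx : x ∈ freePart K deg i) (hy : y ∈ freePart K deg j) (hz : z ∈ freePart K deg k) :
      LieRelator (x * (y * z) - (x * y) * z - koszulSign i j • (y * (x * z)))
  | self {x : FreeNonUnitalNonAssocAlgebra K X} (hx : x ∈ freePart K deg 0) : LieRelator (x * x)

theorem LieRelator.homogeneous {t : FreeNonUnitalNonAssocAlgebra K X}
    (h : LieRelator K deg t) : ∃ i, t ∈ freePart K deg i := by
  cases h with
  | @skew i j x y hx hy =>
    have h := mul_mem_freePart K deg hy hx
    rw [add_comm] at h
    exact ⟨i + j, add_mem (mul_mem_freePart K deg hx hy) (zsmul_mem h _)⟩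
  | @jacobi i j k x y z hx hy hz =>
    have h1 := mul_mem_freePart K deg hx (mul_mem_freePart K deg hy hz)
    have h2 := mul_mem_freePart K deg (mul_mem_freePart K deg hx hy) hz
    have h3 := mul_mem_freePart K deg hy (mul_mem_freePart K deg hx hz)
    rw [add_assoc] at h2
    rw [add_left_comm] at h3
    exact ⟨i + (j + k), sub_mem (sub_mem h1 h2) (zsmul_mem h3 _)⟩
  | @self x hx => exact ⟨0 + 0, mul_mem_freePart K deg hx hx⟩

variable (rels : Set (FreeNonUnitalNonAssocAlgebra K X))

/-- The two-sided ideal generated by the Lie superalgebra identities and by the relators `rels`. -/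
noncomputable def presentedIdeal : Submodule K (FreeNonUnitalNonAssocAlgebra K X) :=
  sInf {I | ({t | LieRelator K deg t} ∪ rels ⊆ (I : Set _)) ∧
    ∀ x ∈ I, ∀ y, x * y ∈ I ∧ y * x ∈ I}

theorem relator_mem {t : FreeNonUnitalNonAssocAlgebra K X} (h : LieRelator K deg t ∨ t ∈ rels) :
    t ∈ presentedIdeal K deg rels :=
  Submodule.mem_sInf.2 fun _ hI => hI.1 h

theorem mul_mem_presentedIdeal {x : FreeNonUnitalNonAssocAlgebra K X}
    (hx : x ∈ presentedIdeal K deg rels) (y : FreeNonUnitalNonAssocAlgebra K X) :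
    x * y ∈ presentedIdeal K deg rels ∧ y * x ∈ presentedIdeal K deg rels :=
  ⟨Submodule.mem_sInf.2 fun I hI => (hI.2 x (Submodule.mem_sInf.1 hx I hI) y).1,
   Submodule.mem_sInf.2 fun I hI => (hI.2 x (Submodule.mem_sInf.1 hx I hI) y).2⟩

/-- If all relators are homogeneous, then the ideal is graded. -/
theorem presentedIdeal_graded (hrels : ∀ t ∈ rels, ∃ i, t ∈ freePart K deg i) :
    presentedIdeal K deg rels ≤ (presentedIdeal K deg rels ⊓ freePart K deg 0) ⊔
      (presentedIdeal K deg rels ⊓ freePart K deg 1) := by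
  refine sInf_le ⟨?_, ?_⟩
  · intro t ht
    obtain ⟨i, hi⟩ : ∃ i, t ∈ freePart K deg i :=
      ht.elim (fun h => LieRelator.homogeneous K deg h) (fun h => hrels t h)
    exact le_graded i (relator_mem K deg rels ht) hi
  · have key : ∀ i j x y, x ∈ presentedIdeal K deg rels ⊓ freePart K deg i →
        y ∈ freePart K deg j →
        x * y ∈ (presentedIdeal K deg rels ⊓ freePart K deg 0) ⊔
          (presentedIdeal K deg rels ⊓ freePart K deg 1) ∧
        y * x ∈ (presentedIdeal K deg rels ⊓ freePart K deg 0) ⊔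
          (presentedIdeal K deg rels ⊓ freePart K deg 1) :=
      fun i j x y hx hy =>
        ⟨le_graded (i + j) (mul_mem_presentedIdeal K deg rels hx.1 y).1
          (mul_mem_freePart K deg hx.2 hy),
         le_graded (j + i) (mul_mem_presentedIdeal K deg rels hx.1 y).2
          (mul_mem_freePart K deg hy hx.2)⟩
    intro x hx y
    obtain ⟨x0, hx0, x1, hx1, rfl⟩ := Submodule.mem_sup.1 hx
    obtain ⟨y0, hy0, y1, hy1, rfl⟩ := exists_add (isCompl_freePart K deg) y
    simp only [mul_add, add_mul]
    exact ⟨add_mem (add_mem (key _ _ _ _ hx0 hy0).1 (key _ _ _ _ hx1 hy0).1)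
        (add_mem (key _ _ _ _ hx0 hy1).1 (key _ _ _ _ hx1 hy1).1),
      add_mem (add_mem (key _ _ _ _ hx0 hy0).2 (key _ _ _ _ hx0 hy1).2)
        (add_mem (key _ _ _ _ hx1 hy0).2 (key _ _ _ _ hx1 hy1).2)⟩

/-- The bracket on the quotient, induced by the product of the free nonassociative algebra. -/
noncomputable def presentedBracket :
    (FreeNonUnitalNonAssocAlgebra K X ⧸ presentedIdeal K deg rels) →ₗ[K]
      (FreeNonUnitalNonAssocAlgebra K X ⧸ presentedIdeal K deg rels) →ₗ[K]
        (FreeNonUnitalNonAssocAlgebra K X ⧸ presentedIdeal K deg rels) :=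
  (presentedIdeal K deg rels).liftQ
    { toFun := fun x => (presentedIdeal K deg rels).liftQ
        ((presentedIdeal K deg rels).mkQ ∘ₗ LinearMap.mulLeft K x)
        (fun y hy => (Submodule.Quotient.mk_eq_zero _).2
          (mul_mem_presentedIdeal K deg rels hy x).2)
      map_add' := fun x x' => by
        refine Submodule.linearMap_qext _ (LinearMap.ext fun y => ?_)
        change (presentedIdeal K deg rels).mkQ ((x + x') * y) =
          (presentedIdeal K deg rels).mkQ (x * y) + (presentedIdeal K deg rels).mkQ (x' * y)
        rw [add_mul, map_add]
      map_smul' := fun c x => by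
        refine Submodule.linearMap_qext _ (LinearMap.ext fun y => ?_)
        change (presentedIdeal K deg rels).mkQ ((c • x) * y) =
          c • (presentedIdeal K deg rels).mkQ (x * y)
        rw [smul_mul_assoc, map_smul] }
    (fun x hx => by
      refine Submodule.linearMap_qext _ (LinearMap.ext fun y => ?_)
      exact (Submodule.Quotient.mk_eq_zero _).2 (mul_mem_presentedIdeal K deg rels hx y).1)

theorem presentedBracket_mk (x y : FreeNonUnitalNonAssocAlgebra K X) :
    presentedBracket K deg rels ((presentedIdeal K deg rels).mkQ x)
      ((presentedIdeal K deg rels).mkQ y) = (presentedIdeal K deg rels).mkQ (x * y) := rfl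

/-- The Lie superalgebra presented by a graded set `X` of generators and a set `rels` of
homogeneous relators: the quotient of the free nonassociative algebra by the ideal generated by
the Lie superalgebra identities and `rels`. -/
@[reducible] noncomputable def presented (hrels : ∀ t ∈ rels, ∃ i, t ∈ freePart K deg i) :
    LieSuperalgebra K (FreeNonUnitalNonAssocAlgebra K X ⧸ presentedIdeal K deg rels) where
  part i := (freePart K deg i).map (presentedIdeal K deg rels).mkQ
  isCompl_part := isCompl_map (isCompl_freePart K deg) (presentedIdeal_graded K deg rels hrels)
  bracket := presentedBracket K deg rels
  bracket_mem := by
    rintro i j _ _ ⟨x, hx, rfl⟩ ⟨y, hy, rfl⟩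
    exact ⟨x * y, mul_mem_freePart K deg hx hy, rfl⟩
  bracket_skew := by
    rintro i j _ _ ⟨x, hx, rfl⟩ ⟨y, hy, rfl⟩
    rw [presentedBracket_mk, presentedBracket_mk, eq_neg_iff_add_eq_zero, ← map_zsmul, ← map_add]
    exact (Submodule.Quotient.mk_eq_zero _).2 (relator_mem K deg rels (.inl (.skew hx hy)))
  bracket_jacobi := by
    rintro i j k _ _ _ ⟨x, hx, rfl⟩ ⟨y, hy, rfl⟩ ⟨z, hz, rfl⟩
    simp only [presentedBracket_mk]
    rw [← sub_eq_zero, ← map_zsmul, ← map_add, ← map_sub, ← sub_sub]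
    exact (Submodule.Quotient.mk_eq_zero _).2 (relator_mem K deg rels (.inl (.jacobi hx hy hz)))
  bracket_self := by
    rintro _ ⟨x, hx, rfl⟩
    rw [presentedBracket_mk]
    exact (Submodule.Quotient.mk_eq_zero _).2 (relator_mem K deg rels (.inl (.self hx)))

end Presentation

section Matrices

/-- The degree of a row or column index: the first `m` indices are even, the last `n` are odd. -/
def indexDegree (m n : ℕ) : Fin m ⊕ Fin n → ZMod 2 := Sum.elim (fun _ => 0) (fun _ => 1)

variable {K A : Type*} [CommRing K] [Ring A] [Algebra K A] (m n : ℕ)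
  (𝒜 : ZMod 2 → Submodule K A)

/-- The matrices of degree `d`: the entry at `(i, j)` is homogeneous of degree `d + |i| + |j|`. -/
def matrixPart (d : ZMod 2) : Submodule K (Matrix (Fin m ⊕ Fin n) (Fin m ⊕ Fin n) A) where
  carrier := {M | ∀ i j, M i j ∈ 𝒜 (d + indexDegree m n i + indexDegree m n j)}
  add_mem' hM hN i j := add_mem (hM i j) (hN i j)
  zero_mem' _ _ := zero_mem _
  smul_mem' c _ hM i j := Submodule.smul_mem _ c (hM i j)

/-- The associative superalgebra of `(m + n) × (m + n)` matrices over `A`. -/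
noncomputable instance matrixGraded [GradedAlgebra 𝒜] : GradedAlgebra (matrixPart m n 𝒜) where
  one_mem i j := by
    by_cases h : i = j
    · subst h
      have h2 : ∀ a : ZMod 2, 0 + a + a = 0 := by decide
      rw [Matrix.one_apply_eq, h2]
      exact SetLike.one_mem_graded 𝒜
    · rw [Matrix.one_apply_ne h]
      exact zero_mem _
  mul_mem d e M N hM hN i j := by
    rw [Matrix.mul_apply]
    refine sum_mem fun k _ => ?_
    have h := SetLike.mul_mem_graded (hM i k) (hN k j)
    have h2 : ∀ a b c d e : ZMod 2, d + a + b + (e + b + c) = d + e + a + c := by decide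
    rwa [h2] at h
  toDecomposition := by
    refine DirectSum.IsInternal.chooseDecomposition _
      ((DirectSum.isInternal_submodule_iff_isCompl _ (i := 0) (j := 1) (by decide) zmod_two_univ).2 ?_)
    have hA : IsCompl (𝒜 0) (𝒜 1) :=
      (DirectSum.isInternal_submodule_iff_isCompl 𝒜 (i := 0) (j := 1) (by decide) zmod_two_univ).1 (DirectSum.Decomposition.isInternal 𝒜)
    have hA' : ∀ d, IsCompl (𝒜 d) (𝒜 (1 + d)) := by
      intro d
      rcases zmod_two_cases d with rfl | rfl
      · exact hA
      · exact hA.symm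
    constructor
    · rw [Submodule.disjoint_def]
      intro M h0 h1
      ext i j
      have h0' := h0 i j
      have h1' := h1 i j
      rw [zero_add] at h0'
      rw [add_assoc] at h1'
      exact (Submodule.disjoint_def.1 (hA' _).disjoint) _ h0' h1'
    · rw [codisjoint_iff, eq_top_iff]
      intro M _
      have hM : ∀ i j, ∃ y ∈ 𝒜 (indexDegree m n i + indexDegree m n j),
          ∃ z ∈ 𝒜 (1 + (indexDegree m n i + indexDegree m n j)), y + z = M i j :=
        fun i j => Submodule.mem_sup.1 ((hA' _).sup_eq_top ▸ Submodule.mem_top)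
      choose Y hY Z hZ h using hM
      refine Submodule.mem_sup.2 ⟨Matrix.of Y, fun i j => ?_, Matrix.of Z, fun i j => ?_, ?_⟩
      · rw [zero_add]; exact hY i j
      · rw [add_assoc]; exact hZ i j
      · ext i j; exact h i j

/-- The underlying module of `gl(m, n, A)`: all `(m + n) × (m + n)` matrices over `A`. -/
def gl {K A : Type*} [CommRing K] [Ring A] [Algebra K A] (m n : ℕ)
    (_ : ZMod 2 → Submodule K A) : Type _ :=
  Matrix (Fin m ⊕ Fin n) (Fin m ⊕ Fin n) A

instance : AddCommGroup (gl m n 𝒜) :=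
  inferInstanceAs (AddCommGroup (Matrix (Fin m ⊕ Fin n) (Fin m ⊕ Fin n) A))

instance : Module K (gl m n 𝒜) :=
  inferInstanceAs (Module K (Matrix (Fin m ⊕ Fin n) (Fin m ⊕ Fin n) A))

variable [GradedAlgebra 𝒜]

/-- The Lie superalgebra `gl(m, n, A)`, with the supercommutator of matrices as bracket. -/
noncomputable instance : LieSuperalgebra K (gl m n 𝒜) :=
  ofAssociative (matrixPart m n 𝒜)

/-- The matrix `E_{ij}(a)`, with entry `a` at the position `(i, j)` and zero elsewhere. -/
def glE {K A : Type*} [CommRing K] [Ring A] [Algebra K A] (m n : ℕ)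
    (𝒜 : ZMod 2 → Submodule K A) (i j : Fin m ⊕ Fin n) (a : A) : gl m n 𝒜 :=
  Matrix.single i j a

/-- The generators of `sl(m, n, A)`: the `E_{ij}(a)` with `i ≠ j` and `a` homogeneous. -/
noncomputable def slGenerators {K A : Type*} [CommRing K] [Ring A] [Algebra K A] (m n : ℕ)
    (𝒜 : ZMod 2 → Submodule K A) : Set (gl m n 𝒜) :=
  {M | ∃ (i j : Fin m ⊕ Fin n) (d : ZMod 2) (a : A), i ≠ j ∧ a ∈ 𝒜 d ∧ M = glE m n 𝒜 i j a}

theorem glE_mem (i j : Fin m ⊕ Fin n) {d : ZMod 2} {a : A} (ha : a ∈ 𝒜 d) :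
    glE m n 𝒜 i j a ∈ part (K := K) (indexDegree m n i + indexDegree m n j + d) := by
  intro k l
  change Matrix.single i j a k l ∈ _
  by_cases h : i = k ∧ j = l
  · obtain ⟨rfl, rfl⟩ := h
    have h2 : ∀ a b d : ZMod 2, a + b + d + a + b = d := by decide
    rw [Matrix.single_apply_same, h2]
    exact ha
  · rw [Matrix.single_apply_of_ne _ _ _ _ _ h]
    exact zero_mem _

/-- The underlying module of `sl(m, n, A)`: the subalgebra of `gl(m, n, A)` generated by the
`E_{ij}(a)` with `i ≠ j` and `a` homogeneous. -/
noncomputable abbrev sl : Submodule K (gl m n 𝒜) := subalgebraClosure K (slGenerators m n 𝒜)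

/-- The Lie superalgebra `sl(m, n, A)`. -/
noncomputable instance : LieSuperalgebra K (sl m n 𝒜) :=
  restrict (sl m n 𝒜) (bracket_mem_subalgebraClosure _) (subalgebraClosure_graded _ (by
    rintro _ ⟨i, j, d, a, -, ha, rfl⟩
    exact ⟨_, glE_mem m n 𝒜 i j ha⟩))

/-- The element `E_{ij}(a)` of `sl(m, n, A)`, for `i ≠ j` and `a` homogeneous of degree `d`. -/
noncomputable def slE {i j : Fin m ⊕ Fin n} (hij : i ≠ j) {d : ZMod 2} (a : 𝒜 d) : sl m n 𝒜 :=
  ⟨glE m n 𝒜 i j a, subset_subalgebraClosure _ ⟨i, j, d, a, hij, a.2, rfl⟩⟩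

end Matrices

section Steinberg

variable {K A : Type*} [CommRing K] [Ring A] [Algebra K A] (m n : ℕ)
  (𝒜 : ZMod 2 → Submodule K A)

/-- The symbols `F_{ij}(a)` with `i ≠ j` and `a` a homogeneous element, of degree `d`. -/
structure StGen where
  row : Fin m ⊕ Fin n
  col : Fin m ⊕ Fin n
  ne : row ≠ col
  d : ZMod 2
  a : 𝒜 d

/-- `|F_{ij}(a)| = |i| + |j| + |a|`. -/
def StGen.degree (g : StGen m n 𝒜) : ZMod 2 :=
  indexDegree m n g.row + indexDegree m n g.col + g.d

/-- The symbol `F_{ij}(a)` in the free nonassociative algebra. -/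
noncomputable def freeF {i j : Fin m ⊕ Fin n} (hij : i ≠ j) {d : ZMod 2} (a : 𝒜 d) :
    FreeNonUnitalNonAssocAlgebra K (StGen m n 𝒜) :=
  FreeNonUnitalNonAssocAlgebra.of K ⟨i, j, hij, d, a⟩

theorem freeF_mem {i j : Fin m ⊕ Fin n} (hij : i ≠ j) {d : ZMod 2} (a : 𝒜 d) :
    freeF m n 𝒜 hij a ∈
      freePart K (StGen.degree m n 𝒜) (indexDegree m n i + indexDegree m n j + d) :=
  of_mem_freePart K (StGen.degree m n 𝒜) ⟨i, j, hij, d, a⟩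

variable [GradedAlgebra 𝒜]

/-- The Steinberg relators, for homogeneous `a`, `b`: `a ↦ F_{ij}(a)` is linear,
`[F_{ij}(a), F_{jk}(b)] = F_{ik}(ab)` for distinct `i, j, k`, and `[F_{ij}(a), F_{kl}(b)] = 0` for
`j ≠ k`, `i ≠ l`. -/
inductive StRelator : FreeNonUnitalNonAssocAlgebra K (StGen m n 𝒜) → Prop
  | add {i j : Fin m ⊕ Fin n} (hij : i ≠ j) {d : ZMod 2} (a b : 𝒜 d) :
      StRelator (freeF m n 𝒜 hij (a + b) - freeF m n 𝒜 hij a - freeF m n 𝒜 hij b)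
  | smul {i j : Fin m ⊕ Fin n} (hij : i ≠ j) {d : ZMod 2} (c : K) (a : 𝒜 d) :
      StRelator (freeF m n 𝒜 hij (c • a) - c • freeF m n 𝒜 hij a)
  | mul {i j k : Fin m ⊕ Fin n} (hij : i ≠ j) (hjk : j ≠ k) (hik : i ≠ k) {d e : ZMod 2}
      (a : 𝒜 d) (b : 𝒜 e) :
      StRelator (freeF m n 𝒜 hij a * freeF m n 𝒜 hjk b -
        freeF m n 𝒜 hik (d := d + e) ⟨(a : A) * b, SetLike.mul_mem_graded a.2 b.2⟩)
  | comm {i j k l : Fin m ⊕ Fin n} (hij : i ≠ j) (hkl : k ≠ l) (hjk : j ≠ k) (hil : i ≠ l)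
      {d e : ZMod 2} (a : 𝒜 d) (b : 𝒜 e) :
      StRelator (freeF m n 𝒜 hij a * freeF m n 𝒜 hkl b)

theorem StRelator.homogeneous {t : FreeNonUnitalNonAssocAlgebra K (StGen m n 𝒜)}
    (h : StRelator m n 𝒜 t) : ∃ i, t ∈ freePart K (StGen.degree m n 𝒜) i := by
  cases h with
  | add hij a b =>
    exact ⟨_, sub_mem (sub_mem (freeF_mem m n 𝒜 hij (a + b)) (freeF_mem m n 𝒜 hij a))
      (freeF_mem m n 𝒜 hij b)⟩
  | smul hij c a =>
    exact ⟨_, sub_mem (freeF_mem m n 𝒜 hij (c • a))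
      (Submodule.smul_mem _ c (freeF_mem m n 𝒜 hij a))⟩
  | @mul i j k hij hjk hik d e a b =>
    have h1 := mul_mem_freePart K _ (freeF_mem (K := K) m n 𝒜 hij a) (freeF_mem m n 𝒜 hjk b)
    have h2 : ∀ a b c d e : ZMod 2, a + b + d + (b + c + e) = a + c + (d + e) := by decide
    rw [h2] at h1
    exact ⟨_, sub_mem h1 (freeF_mem m n 𝒜 hik _)⟩
  | comm hij hkl hjk hil a b =>
    exact ⟨_, mul_mem_freePart K _ (freeF_mem m n 𝒜 hij a) (freeF_mem m n 𝒜 hkl b)⟩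

/-- The underlying module of the Steinberg Lie superalgebra `st(m, n, A)`. -/
noncomputable abbrev st : Type _ :=
  FreeNonUnitalNonAssocAlgebra K (StGen m n 𝒜) ⧸
    presentedIdeal K (StGen.degree m n 𝒜) {t | StRelator m n 𝒜 t}

/-- The Steinberg Lie superalgebra `st(m, n, A)`, presented by the homogeneous generators
`F_{ij}(a)` and the Steinberg relations. -/
noncomputable instance : LieSuperalgebra K (st m n 𝒜) :=
  presented K (StGen.degree m n 𝒜) {t | StRelator m n 𝒜 t}
    (fun _ h => StRelator.homogeneous m n 𝒜 h)

/-- The generator `F_{ij}(a)` of `st(m, n, A)`, for `i ≠ j` and `a` homogeneous of degree `d`. -/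
noncomputable def stF {i j : Fin m ⊕ Fin n} (hij : i ≠ j) {d : ZMod 2} (a : 𝒜 d) : st m n 𝒜 :=
  Submodule.mkQ _ (freeF m n 𝒜 hij a)

end Steinberg

end LieSuperalgebra

open LieSuperalgebra

universe u v w

/-!
The map `st(m, n, A) → sl(m, n, A)` exists because the matrices `E_{ij}(a)` satisfy the Steinberg
relations, and it is onto because they generate `sl(m, n, A)`. As `F_{ij}(a) = [F_{ip}(a), F_{pj}(1)]`
for any third index `p`, the algebra `st(m, n, A)` is perfect, hence so is `sl(m, n, A)`.

*The kernel is central.* Let `H` (`cartan`) be the span of the brackets `[F_{kl}(a), F_{lk}(b)]`. By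
the Jacobi identity `H` normalizes each root submodule `F_{ij}(A)` (`bracket_cartan_rootSpace`), so
that `st(m, n, A)` is the sum of `H` and the root submodules (`rootSum_sup_cartan`). The image of `H`
is diagonal and the `F_{ij}(A)` are mapped injectively to the off-diagonal entries. Hence the kernel
lies in `H` (`ker_le_cartan`), and its bracket with `F_{ij}(A)` lies in `F_{ij}(A)` and in the kernel,
so vanishes.

*Universality.* For a central extension `f : M → sl(m, n, A)` the bracket `[x, y]` in `M` depends only
on `f x` and `f y`; this gives a bilinear map `w` on `sl(m, n, A)` with values in `M`, which inherits
the Jacobi identity. Among five indices there is one outside any four, and expanding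
`E_{kl}(b) = [E_{kp}(b), E_{pl}(1)]` by the Jacobi identity shows that `w(E_{ij}(a), E_{kl}(b)) = 0`
for `j ≠ k`, `i ≠ l` (`lift_bracket_slE_comm`). In the same way `w(E_{ij}(a), E_{jk}(b))` depends
only on `i`, `k` and `ab` (`lift_bracket_slE_mul`). So the elements `w(E_{ip}(a), E_{pj}(1))` lift
`E_{ij}(a)` and satisfy the Steinberg relations. The lift is unique because two lifts differ by
central elements and `st(m, n, A)` is perfect.
-/

namespace LieSuperalgebra

/-! ### Homogeneous elements -/

section Homogeneous

variable {K L M : Type*} [CommRing K] [AddCommGroup L] [Module K L] [LieSuperalgebra K L]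
  [AddCommGroup M] [Module K M] [LieSuperalgebra K M]

theorem Hom.ext_toLinearMap {f g : Hom K L M} (h : f.toLinearMap = g.toLinearMap) : f = g := by
  cases f
  cases g
  cases h
  rfl

/-- A surjective homomorphism is surjective in each degree. -/
theorem Hom.exists_mem_part {f : Hom K L M} (hf : Function.Surjective f.toLinearMap) {i : ZMod 2}
    {x : M} (hx : x ∈ part (K := K) i) : ∃ y ∈ part (K := K) i, f.toLinearMap y = x := by
  obtain ⟨t, rfl⟩ := hf x
  obtain ⟨y, hy, z, hz, rfl⟩ := exists_add (isCompl_part (K := K)) t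
  rw [map_add] at hx ⊢
  have hy' := f.map_part _ _ hy
  have hz' := f.map_part _ _ hz
  rcases zmod_two_cases i with rfl | rfl
  · have h := eq_zero_of_add (isCompl_part (K := K)) (add_mem hy' (neg_mem hx)) hz' (by abel)
    exact ⟨y, hy, by rw [h.2, add_zero]⟩
  · have h := eq_zero_of_add (isCompl_part (K := K)) hy' (add_mem hz' (neg_mem hx)) (by abel)
    exact ⟨z, hz, by rw [h.1, zero_add]⟩

theorem bracket_bracket {i j k : ZMod 2} {x y z : L} (hx : x ∈ part (K := K) i)
    (hy : y ∈ part (K := K) j) (hz : z ∈ part (K := K) k) :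
    bracket (K := K) (bracket (K := K) x y) z =
      bracket (K := K) x (bracket (K := K) y z) -
        koszulSign i j • bracket (K := K) y (bracket (K := K) x z) := by
  rw [bracket_jacobi hx hy hz, add_sub_cancel_right]

theorem bracket_eq_zero_symm {i j : ZMod 2} {x y : L} (hx : x ∈ part (K := K) i)
    (hy : y ∈ part (K := K) j) (h : bracket (K := K) x y = 0) : bracket (K := K) y x = 0 := by
  rw [bracket_skew hy hx, h, smul_zero, neg_zero]

theorem bracket_mem_symm {N : Submodule K L} {i j : ZMod 2} {x y : L} (hx : x ∈ part (K := K) i)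
    (hy : y ∈ part (K := K) j) (h : bracket (K := K) x y ∈ N) : bracket (K := K) y x ∈ N := by
  rw [bracket_skew hy hx]
  exact neg_mem (zsmul_mem h _)

/-- A homogeneous element centralizes each homogeneous component of an element that it
centralizes; so its centralizer is a subalgebra. -/
theorem bracket_bracket_eq_zero {i : ZMod 2} {c x y : L} (hc : c ∈ part (K := K) i)
    (hx : bracket (K := K) c x = 0) (hy : bracket (K := K) c y = 0) :
    bracket (K := K) c (bracket (K := K) x y) = 0 := by
  have key : ∀ t : L, bracket (K := K) c t = 0 → ∃ t0 ∈ part (K := K) 0, ∃ t1 ∈ part (K := K) 1,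
      bracket (K := K) c t0 = 0 ∧ bracket (K := K) c t1 = 0 ∧ t0 + t1 = t := by
    intro t ht
    obtain ⟨t0, h0, t1, h1, rfl⟩ := exists_add (isCompl_part (K := K)) t
    rw [map_add] at ht
    have m0 := bracket_mem hc h0
    have m1 := bracket_mem hc h1
    have : bracket (K := K) c t0 = 0 ∧ bracket (K := K) c t1 = 0 := by
      rcases zmod_two_cases i with rfl | rfl
      · exact eq_zero_of_add isCompl_part m0 m1 ht
      · exact (eq_zero_of_add isCompl_part m1 m0 ((add_comm _ _).trans ht)).symm
    exact ⟨t0, h0, t1, h1, this.1, this.2, rfl⟩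
  have hom : ∀ {j k : ZMod 2} {s t : L}, s ∈ part (K := K) j → t ∈ part (K := K) k →
      bracket (K := K) c s = 0 → bracket (K := K) c t = 0 →
      bracket (K := K) c (bracket (K := K) s t) = 0 := by
    intro j k s t hs ht es et
    rw [bracket_jacobi hc hs ht, es, et]
    simp
  obtain ⟨x0, hx0, x1, hx1, ex0, ex1, rfl⟩ := key x hx
  obtain ⟨y0, hy0, y1, hy1, ey0, ey1, rfl⟩ := key y hy
  simp only [map_add, LinearMap.add_apply]
  rw [hom hx0 hy0 ex0 ey0, hom hx0 hy1 ex0 ey1, hom hx1 hy0 ex1 ey0, hom hx1 hy1 ex1 ey1]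
  simp

end Homogeneous

/-! ### Central extensions -/

section CentralExtension

variable {K M P U : Type*} [CommRing K] [AddCommGroup M] [Module K M] [LieSuperalgebra K M]
  [AddCommGroup P] [Module K P] [LieSuperalgebra K P]
  [AddCommGroup U] [Module K U] [LieSuperalgebra K U]

/-- In a central extension, the bracket of two elements depends only on their images. -/
theorem IsCentralExtension.bracket_congr {f : Hom K M P} (hf : IsCentralExtension K f)
    {x x' y y' : M} (hx : f.toLinearMap x = f.toLinearMap x')
    (hy : f.toLinearMap y = f.toLinearMap y') :
    bracket (K := K) x y = bracket (K := K) x' y' := by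
  have h1 : bracket (K := K) (x - x') y = 0 := hf.2 _ (by rw [map_sub, hx, sub_self]) _
  have h2 : bracket (K := K) x' (y - y') = 0 := by
    have hc : f.toLinearMap (y - y') = 0 := by rw [map_sub, hy, sub_self]
    -- A central element is only assumed to kill the bracket on the left; for the other side
    -- its homogeneous components are needed, and they are central too.
    obtain ⟨a, ha, b, hb, e⟩ := exists_add (isCompl_part (K := K)) (y - y')
    obtain ⟨s, hs, t, ht, rfl⟩ := exists_add (isCompl_part (K := K)) x'
    rw [← e, map_add] at hc
    have hab := eq_zero_of_add (isCompl_part (K := K)) (f.map_part _ _ ha) (f.map_part _ _ hb) hc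
    rw [← e]
    simp only [map_add, LinearMap.add_apply]
    rw [bracket_eq_zero_symm ha hs (hf.2 _ hab.1 _), bracket_eq_zero_symm ha ht (hf.2 _ hab.1 _),
      bracket_eq_zero_symm hb hs (hf.2 _ hab.2 _), bracket_eq_zero_symm hb ht (hf.2 _ hab.2 _)]
    simp
  rw [map_sub, LinearMap.sub_apply, sub_eq_zero] at h1
  rw [map_sub, sub_eq_zero] at h2
  rw [h1, h2]

/-- The bracket of `M`, as a bilinear map on the base `P` of the central extension `f : M → P`:
`w (f x) (f y) = [x, y]`. -/
theorem IsCentralExtension.exists_lift_bracket {f : Hom K M P} (hf : IsCentralExtension K f) :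
    ∃ w : P →ₗ[K] P →ₗ[K] M, ∀ x y : M,
      w (f.toLinearMap x) (f.toLinearMap y) = bracket (K := K) x y := by
  have hs := Function.surjInv_eq hf.1
  refine ⟨LinearMap.mk₂ K
    (fun x y => bracket (K := K) (Function.surjInv hf.1 x) (Function.surjInv hf.1 y))
    (fun x x' y => ?_) (fun c x y => ?_) (fun x y y' => ?_) (fun c x y => ?_), fun x y => ?_⟩
  · rw [← LinearMap.add_apply, ← map_add]
    exact hf.bracket_congr (by simp [hs]) rfl
  · rw [← LinearMap.smul_apply, ← map_smul]
    exact hf.bracket_congr (by simp [hs]) rfl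
  · rw [← map_add]
    exact hf.bracket_congr rfl (by simp [hs])
  · rw [← map_smul]
    exact hf.bracket_congr rfl (by simp [hs])
  · exact hf.bracket_congr (hs _) (hs _)

/-- The bilinear map `w` on the base of a central extension inherits the Jacobi identity from the
total space. -/
theorem IsCentralExtension.lift_bracket_jacobi {f : Hom K M P} (hf : IsCentralExtension K f)
    {w : P →ₗ[K] P →ₗ[K] M}
    (hw : ∀ x y : M, w (f.toLinearMap x) (f.toLinearMap y) = bracket (K := K) x y)
    {i j k : ZMod 2} {x y z : P} (hx : x ∈ part (K := K) i) (hy : y ∈ part (K := K) j)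
    (hz : z ∈ part (K := K) k) :
    w x (bracket (K := K) y z) =
      w (bracket (K := K) x y) z + koszulSign i j • w y (bracket (K := K) x z) := by
  obtain ⟨x, hx', rfl⟩ := Hom.exists_mem_part hf.1 hx
  obtain ⟨y, hy', rfl⟩ := Hom.exists_mem_part hf.1 hy
  obtain ⟨z, hz', rfl⟩ := Hom.exists_mem_part hf.1 hz
  simp only [← f.map_bracket, hw]
  exact bracket_jacobi hx' hy' hz'

theorem IsCentralExtension.lift_bracket_mem {f : Hom K M P} (hf : IsCentralExtension K f)
    {w : P →ₗ[K] P →ₗ[K] M}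
    (hw : ∀ x y : M, w (f.toLinearMap x) (f.toLinearMap y) = bracket (K := K) x y)
    {i j : ZMod 2} {x y : P} (hx : x ∈ part (K := K) i) (hy : y ∈ part (K := K) j) :
    w x y ∈ part (K := K) (i + j) := by
  obtain ⟨x, hx', rfl⟩ := Hom.exists_mem_part hf.1 hx
  obtain ⟨y, hy', rfl⟩ := Hom.exists_mem_part hf.1 hy
  rw [hw]
  exact bracket_mem hx' hy'

theorem IsCentralExtension.map_lift_bracket {f : Hom K M P} (hf : IsCentralExtension K f)
    {w : P →ₗ[K] P →ₗ[K] M}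
    (hw : ∀ x y : M, w (f.toLinearMap x) (f.toLinearMap y) = bracket (K := K) x y) (x y : P) :
    f.toLinearMap (w x y) = bracket (K := K) x y := by
  obtain ⟨x, rfl⟩ := hf.1 x
  obtain ⟨y, rfl⟩ := hf.1 y
  rw [hw, f.map_bracket]

/-- Two homomorphisms from a perfect Lie superalgebra into a central extension agree as soon as
they agree on the base. -/
theorem IsCentralExtension.hom_ext {f : Hom K M P} (hf : IsCentralExtension K f)
    (hU : IsPerfect K U) {θ θ' : Hom K U M}
    (h : ∀ x, f.toLinearMap (θ.toLinearMap x) = f.toLinearMap (θ'.toLinearMap x)) : θ = θ' := by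
  refine Hom.ext_toLinearMap (LinearMap.ext_on hU ?_)
  rintro _ ⟨x, y, rfl⟩
  rw [θ.map_bracket, θ'.map_bracket]
  exact hf.bracket_congr (h x) (h y)

theorem IsPerfect.of_surjective (hU : IsPerfect K U) (f : Hom K U P)
    (hf : Function.Surjective f.toLinearMap) : IsPerfect K P := by
  rw [IsPerfect, eq_top_iff, ← LinearMap.range_eq_top.2 hf, LinearMap.range_eq_map, ← hU,
    Submodule.map_span, Submodule.span_le]
  rintro _ ⟨_, ⟨x, y, rfl⟩, rfl⟩
  exact Submodule.subset_span ⟨_, _, f.map_bracket x y⟩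

end CentralExtension

/-! ### Presented Lie superalgebras -/

section Presentation

variable {K X : Type*} [CommRing K] (deg : X → ZMod 2)

/-- The free nonassociative algebra maps to any Lie superalgebra, its product going to the
bracket. -/
theorem exists_free_lift {M : Type*} [AddCommGroup M] [Module K M] [LieSuperalgebra K M]
    (g : X → M) : ∃ φ : FreeNonUnitalNonAssocAlgebra K X →ₗ[K] M,
      (∀ s t, φ (s * t) = bracket (K := K) (φ s) (φ t)) ∧
        ∀ x, φ (FreeNonUnitalNonAssocAlgebra.of K x) = g x := by
  let _ : NonUnitalNonAssocSemiring M :=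
    { (inferInstance : AddCommMonoid M) with
      mul := fun x y => bracket (K := K) x y
      left_distrib := fun x y z => map_add (bracket (K := K) x) y z
      right_distrib := fun x y z => by
        change bracket (K := K) (x + y) z = bracket (K := K) x z + bracket (K := K) y z
        simp
      zero_mul := fun x => by
        change bracket (K := K) 0 x = 0
        simp
      mul_zero := fun x => map_zero (bracket (K := K) x) }
  have : IsScalarTower K M M := ⟨fun c x y => by
    change bracket (K := K) (c • x) y = c • bracket (K := K) x y
    simp⟩
  have : SMulCommClass K M M := ⟨fun c x y => by
    change c • bracket (K := K) x y = bracket (K := K) x (c • y)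
    simp⟩
  let φ := FreeNonUnitalNonAssocAlgebra.lift K g
  exact ⟨(φ : FreeNonUnitalNonAssocAlgebra K X →ₗ[K] M), fun s t => map_mul φ s t,
    fun x => FreeNonUnitalNonAssocAlgebra.lift_of_apply K g x⟩

theorem single_mul_word (v w : FreeMagma X) :
    (MonoidAlgebra.single (v * w) 1 : FreeNonUnitalNonAssocAlgebra K X) =
      MonoidAlgebra.single v 1 * MonoidAlgebra.single w 1 := by
  rw [MonoidAlgebra.single_mul_single, one_mul]

variable (rels : Set (FreeNonUnitalNonAssocAlgebra K X))

/-- A presented Lie superalgebra is generated by the images of the letters. -/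
theorem presented_eq_top
    {N : Submodule K (FreeNonUnitalNonAssocAlgebra K X ⧸ presentedIdeal K deg rels)}
    (hof : ∀ x, (presentedIdeal K deg rels).mkQ (FreeNonUnitalNonAssocAlgebra.of K x) ∈ N)
    (hbr : ∀ s ∈ N, ∀ t ∈ N, presentedBracket K deg rels s t ∈ N) : N = ⊤ := by
  have hw : ∀ w : FreeMagma X,
      (presentedIdeal K deg rels).mkQ (MonoidAlgebra.single w 1) ∈ N := by
    intro w
    induction w using FreeMagma.recOnMul with
    | ih1 x => exact hof x
    | ih2 v w hv hw =>
      rw [single_mul_word, ← presentedBracket_mk]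
      exact hbr _ hv _ hw
  rw [eq_top_iff]
  rintro t -
  obtain ⟨t, rfl⟩ := Submodule.mkQ_surjective _ t
  induction t using MonoidAlgebra.induction_linear with
  | zero => simp
  | add s t hs ht => rw [map_add]; exact add_mem hs ht
  | single w c =>
    have : (MonoidAlgebra.single w c : FreeNonUnitalNonAssocAlgebra K X) =
        c • MonoidAlgebra.single w 1 := by simp
    rw [this, map_smul]
    exact N.smul_mem c (hw w)

/-- The universal property of a presented Lie superalgebra. -/
theorem exists_presented_lift (hrels : ∀ t ∈ rels, ∃ i, t ∈ freePart K deg i)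
    {M : Type*} [AddCommGroup M] [Module K M] [LieSuperalgebra K M] (g : X → M)
    (hg : ∀ x, g x ∈ part (K := K) (deg x))
    (hg' : ∀ φ : FreeNonUnitalNonAssocAlgebra K X →ₗ[K] M,
      (∀ s t, φ (s * t) = bracket (K := K) (φ s) (φ t)) →
      (∀ x, φ (FreeNonUnitalNonAssocAlgebra.of K x) = g x) → ∀ t ∈ rels, φ t = 0) :
    letI := presented K deg rels hrels
    ∃ θ : Hom K (FreeNonUnitalNonAssocAlgebra K X ⧸ presentedIdeal K deg rels) M,
      ∀ x, θ.toLinearMap ((presentedIdeal K deg rels).mkQ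
        (FreeNonUnitalNonAssocAlgebra.of K x)) = g x := by
  let _ := presented K deg rels hrels
  obtain ⟨φ, hmul, hof⟩ := exists_free_lift (K := K) g
  have hword : ∀ w : FreeMagma X,
      φ (MonoidAlgebra.single w 1) ∈ part (K := K) (wordDegree deg w) := by
    intro w
    induction w using FreeMagma.recOnMul with
    | ih1 x => exact (hof x).symm ▸ hg x
    | ih2 v w hv hw =>
      rw [single_mul_word, hmul]
      exact bracket_mem hv hw
  have hpart : ∀ i, ∀ t ∈ freePart K deg i, φ t ∈ part (K := K) i := by
    intro i t ht
    rw [freePart, MonoidAlgebra.supported_eq_span_single] at ht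
    revert t
    change Submodule.span K _ ≤ (part (K := K) i).comap φ
    rw [Submodule.span_le]
    rintro _ ⟨w, hw, rfl⟩
    have hw' : wordDegree deg w = i := hw
    exact hw' ▸ hword w
  have hker : presentedIdeal K deg rels ≤ LinearMap.ker φ := by
    refine sInf_le ⟨?_, fun s hs t => ?_⟩
    · rintro t (ht | ht)
      · cases ht with
        | skew hx hy =>
          have := bracket_skew (hpart _ _ hx) (hpart _ _ hy)
          simp [hmul, this]
        | jacobi hx hy hz =>
          have := bracket_jacobi (hpart _ _ hx) (hpart _ _ hy) (hpart _ _ hz)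
          simp [hmul, this]
        | self hx => simp [hmul, bracket_self (hpart _ _ hx)]
      · exact hg' φ hmul hof t ht
    · rw [LinearMap.mem_ker] at hs
      simp [hmul, hs]
  refine ⟨⟨(presentedIdeal K deg rels).liftQ φ hker, ?_, ?_⟩, hof⟩
  · rintro i _ ⟨t, ht, rfl⟩
    exact hpart i t ht
  · intro x y
    obtain ⟨s, rfl⟩ := Submodule.mkQ_surjective _ x
    obtain ⟨t, rfl⟩ := Submodule.mkQ_surjective _ y
    exact hmul s t

end Presentation

section

variable {K A : Type*} [CommRing K] [Ring A] [Algebra K A] (m n : ℕ)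
  (𝒜 : ZMod 2 → Submodule K A) [GradedAlgebra 𝒜]

/-- The unit of `A`, as an element of degree `0`. -/
def evenOne : 𝒜 0 := ⟨1, SetLike.one_mem_graded 𝒜⟩

/-- The product of homogeneous elements, as an element of the sum of their degrees. -/
def homMul {d e : ZMod 2} (a : 𝒜 d) (b : 𝒜 e) : 𝒜 (d + e) :=
  ⟨(a : A) * b, SetLike.mul_mem_graded a.2 b.2⟩

/-! ### Elementary matrices -/

section Matrices

theorem bracket_glE_mul {i j k : Fin m ⊕ Fin n} (hik : i ≠ k) {d e : ZMod 2}
    (a : 𝒜 d) (b : 𝒜 e) :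
    bracket (K := K) (glE m n 𝒜 i j (a : A)) (glE m n 𝒜 j k (b : A)) =
      glE m n 𝒜 i k ((a : A) * b) := by
  refine (superCommutator_apply (matrixPart m n 𝒜) (glE_mem m n 𝒜 i j a.2)
    (glE_mem m n 𝒜 j k b.2)).trans ?_
  change Matrix.single i j (a : A) * Matrix.single j k (b : A) -
    _ • (Matrix.single j k (b : A) * Matrix.single i j (a : A)) = Matrix.single i k _
  rw [Matrix.single_mul_single_same, Matrix.single_mul_single_of_ne _ _ _ _ hik.symm, smul_zero,
    sub_zero]

theorem bracket_glE_comm {i j k l : Fin m ⊕ Fin n} (hjk : j ≠ k) (hil : i ≠ l) {d e : ZMod 2}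
    (a : 𝒜 d) (b : 𝒜 e) :
    bracket (K := K) (glE m n 𝒜 i j (a : A)) (glE m n 𝒜 k l (b : A)) = 0 := by
  refine (superCommutator_apply (matrixPart m n 𝒜) (glE_mem m n 𝒜 i j a.2)
    (glE_mem m n 𝒜 k l b.2)).trans ?_
  change Matrix.single i j (a : A) * Matrix.single k l (b : A) -
    _ • (Matrix.single k l (b : A) * Matrix.single i j (a : A)) = 0
  rw [Matrix.single_mul_single_of_ne _ _ _ _ hjk, Matrix.single_mul_single_of_ne _ _ _ _ hil.symm,
    smul_zero, sub_zero]

/-- The bracket `[E_{kl}(a), E_{lk}(b)]` is a diagonal matrix. -/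
theorem bracket_glE_apply_of_ne {k l : Fin m ⊕ Fin n} {d e : ZMod 2} (a : 𝒜 d) (b : 𝒜 e)
    {i j : Fin m ⊕ Fin n} (hij : i ≠ j) :
    (bracket (K := K) (glE m n 𝒜 k l (a : A)) (glE m n 𝒜 l k (b : A)) :
      Matrix (Fin m ⊕ Fin n) (Fin m ⊕ Fin n) A) i j = 0 := by
  have h : bracket (K := K) (glE m n 𝒜 k l (a : A)) (glE m n 𝒜 l k (b : A)) =
      (Matrix.single k l (a : A) * Matrix.single l k (b : A) -
      koszulSign _ _ • (Matrix.single l k (b : A) * Matrix.single k l (a : A)) :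
        Matrix (Fin m ⊕ Fin n) (Fin m ⊕ Fin n) A) :=
    superCommutator_apply (matrixPart m n 𝒜) (glE_mem m n 𝒜 k l a.2) (glE_mem m n 𝒜 l k b.2)
  rw [h, Matrix.single_mul_single_same, Matrix.single_mul_single_same, Matrix.sub_apply,
    Matrix.smul_apply, Matrix.single_apply_of_ne, Matrix.single_apply_of_ne, smul_zero, sub_zero]
  · rintro ⟨rfl, rfl⟩; exact hij rfl
  · rintro ⟨rfl, rfl⟩; exact hij rfl

theorem slE_add {i j : Fin m ⊕ Fin n} (hij : i ≠ j) {d : ZMod 2} (a b : 𝒜 d) :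
    slE m n 𝒜 hij (a + b) = slE m n 𝒜 hij a + slE m n 𝒜 hij b :=
  Subtype.ext (Matrix.single_add i j (a : A) (b : A))

theorem slE_smul {i j : Fin m ⊕ Fin n} (hij : i ≠ j) {d : ZMod 2} (c : K) (a : 𝒜 d) :
    slE m n 𝒜 hij (c • a) = c • slE m n 𝒜 hij a :=
  Subtype.ext (Matrix.smul_single c i j (a : A)).symm

theorem slE_mem {i j : Fin m ⊕ Fin n} (hij : i ≠ j) {d : ZMod 2} (a : 𝒜 d) :
    slE m n 𝒜 hij a ∈ part (K := K) (indexDegree m n i + indexDegree m n j + d) :=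
  glE_mem m n 𝒜 i j a.2

theorem bracket_slE_mul {i j k : Fin m ⊕ Fin n} (hij : i ≠ j) (hjk : j ≠ k) (hik : i ≠ k)
    {d e : ZMod 2} (a : 𝒜 d) (b : 𝒜 e) :
    bracket (K := K) (slE m n 𝒜 hij a) (slE m n 𝒜 hjk b) = slE m n 𝒜 hik (homMul 𝒜 a b) :=
  Subtype.ext (bracket_glE_mul m n 𝒜 hik a b)

theorem bracket_slE_comm {i j k l : Fin m ⊕ Fin n} (hij : i ≠ j) (hkl : k ≠ l) (hjk : j ≠ k)
    (hil : i ≠ l) {d e : ZMod 2} (a : 𝒜 d) (b : 𝒜 e) :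
    bracket (K := K) (slE m n 𝒜 hij a) (slE m n 𝒜 hkl b) = 0 :=
  Subtype.ext (bracket_glE_comm m n 𝒜 hjk hil a b)

theorem slE_congr {i j : Fin m ⊕ Fin n} (hij : i ≠ j) {d e : ZMod 2} {a : 𝒜 d} {b : 𝒜 e}
    (h : (a : A) = b) : slE m n 𝒜 hij a = slE m n 𝒜 hij b :=
  Subtype.ext (congrArg (glE m n 𝒜 i j) h)

/-- A homomorphism to `sl(m, n, A)` whose image contains the generators is surjective. -/
theorem surjective_of_slE_mem_range {L : Type*} [AddCommGroup L] [Module K L]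
    [LieSuperalgebra K L] (f : Hom K L (sl m n 𝒜))
    (h : ∀ (i j : Fin m ⊕ Fin n) (hij : i ≠ j) (d : ZMod 2) (a : 𝒜 d),
      slE m n 𝒜 hij a ∈ LinearMap.range f.toLinearMap) :
    Function.Surjective f.toLinearMap := by
  have hle : sl m n 𝒜 ≤ (LinearMap.range f.toLinearMap).map (sl m n 𝒜).subtype := by
    refine sInf_le ⟨?_, ?_⟩
    · rintro _ ⟨i, j, d, a, hij, ha, rfl⟩
      exact ⟨_, h i j hij d ⟨a, ha⟩, rfl⟩
    · rintro _ ⟨_, ⟨x, rfl⟩, rfl⟩ _ ⟨_, ⟨y, rfl⟩, rfl⟩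
      exact ⟨_, ⟨bracket (K := K) x y, rfl⟩, congrArg Subtype.val (f.map_bracket x y)⟩
  rintro ⟨x, hx⟩
  obtain ⟨_, ⟨y, rfl⟩, hy⟩ := hle hx
  exact ⟨y, Subtype.ext hy⟩

end Matrices

/-! ### The Steinberg Lie superalgebra -/

section Steinberg

theorem stF_mem {i j : Fin m ⊕ Fin n} (hij : i ≠ j) {d : ZMod 2} (a : 𝒜 d) :
    stF m n 𝒜 hij a ∈ part (K := K) (indexDegree m n i + indexDegree m n j + d) :=
  ⟨_, freeF_mem m n 𝒜 hij a, rfl⟩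

theorem mkQ_eq_zero_of_stRelator {t : FreeNonUnitalNonAssocAlgebra K (StGen m n 𝒜)}
    (h : StRelator m n 𝒜 t) :
    (presentedIdeal K (StGen.degree m n 𝒜) {t | StRelator m n 𝒜 t}).mkQ t = 0 :=
  (Submodule.Quotient.mk_eq_zero _).2 (relator_mem _ _ _ (.inr h))

theorem stF_add {i j : Fin m ⊕ Fin n} (hij : i ≠ j) {d : ZMod 2} (a b : 𝒜 d) :
    stF m n 𝒜 hij (a + b) = stF m n 𝒜 hij a + stF m n 𝒜 hij b := by
  have h := mkQ_eq_zero_of_stRelator m n 𝒜 (.add hij a b)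
  rw [map_sub, map_sub, sub_sub, sub_eq_zero] at h
  exact h

theorem stF_smul {i j : Fin m ⊕ Fin n} (hij : i ≠ j) {d : ZMod 2} (c : K) (a : 𝒜 d) :
    stF m n 𝒜 hij (c • a) = c • stF m n 𝒜 hij a := by
  have h := mkQ_eq_zero_of_stRelator m n 𝒜 (.smul hij c a)
  rw [map_sub, map_smul, sub_eq_zero] at h
  exact h

theorem bracket_stF_mul {i j k : Fin m ⊕ Fin n} (hij : i ≠ j) (hjk : j ≠ k) (hik : i ≠ k)
    {d e : ZMod 2} (a : 𝒜 d) (b : 𝒜 e) :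
    bracket (K := K) (stF m n 𝒜 hij a) (stF m n 𝒜 hjk b) = stF m n 𝒜 hik (homMul 𝒜 a b) := by
  have h := mkQ_eq_zero_of_stRelator m n 𝒜 (.mul hij hjk hik a b)
  rw [map_sub, sub_eq_zero] at h
  exact h

theorem bracket_stF_comm {i j k l : Fin m ⊕ Fin n} (hij : i ≠ j) (hkl : k ≠ l) (hjk : j ≠ k)
    (hil : i ≠ l) {d e : ZMod 2} (a : 𝒜 d) (b : 𝒜 e) :
    bracket (K := K) (stF m n 𝒜 hij a) (stF m n 𝒜 hkl b) = 0 :=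
  mkQ_eq_zero_of_stRelator m n 𝒜 (.comm hij hkl hjk hil a b)

theorem st_eq_top {N : Submodule K (st m n 𝒜)}
    (hF : ∀ (i j : Fin m ⊕ Fin n) (hij : i ≠ j) (d : ZMod 2) (a : 𝒜 d), stF m n 𝒜 hij a ∈ N)
    (hbr : ∀ x ∈ N, ∀ y ∈ N, bracket (K := K) x y ∈ N) : N = ⊤ :=
  presented_eq_top _ _ (fun x => hF x.row x.col x.ne x.d x.a) hbr

theorem st_hom_ext {M : Type*} [AddCommGroup M] [Module K M] [LieSuperalgebra K M]
    {θ θ' : Hom K (st m n 𝒜) M}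
    (h : ∀ (i j : Fin m ⊕ Fin n) (hij : i ≠ j) (d : ZMod 2) (a : 𝒜 d),
      θ.toLinearMap (stF m n 𝒜 hij a) = θ'.toLinearMap (stF m n 𝒜 hij a)) : θ = θ' := by
  have htop : LinearMap.eqLocus θ.toLinearMap θ'.toLinearMap = ⊤ :=
    st_eq_top m n 𝒜 h fun x hx y hy => by
      rw [LinearMap.mem_eqLocus] at *
      rw [θ.map_bracket, θ'.map_bracket, hx, hy]
  refine Hom.ext_toLinearMap (LinearMap.ext fun x => ?_)
  exact LinearMap.mem_eqLocus.1 (htop ▸ Submodule.mem_top : x ∈ _)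

/-- The universal property of `st(m, n, A)`: elements of a Lie superalgebra which satisfy the
Steinberg relations are the images of the generators under a homomorphism. -/
theorem exists_st_lift {M : Type*} [AddCommGroup M] [Module K M] [LieSuperalgebra K M]
    (X : ∀ {i j : Fin m ⊕ Fin n}, i ≠ j → ∀ {d : ZMod 2}, 𝒜 d → M)
    (hX : ∀ {i j : Fin m ⊕ Fin n} (hij : i ≠ j) {d : ZMod 2} (a : 𝒜 d),
      X hij a ∈ part (K := K) (indexDegree m n i + indexDegree m n j + d))
    (hadd : ∀ {i j : Fin m ⊕ Fin n} (hij : i ≠ j) {d : ZMod 2} (a b : 𝒜 d),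
      X hij (a + b) = X hij a + X hij b)
    (hsmul : ∀ {i j : Fin m ⊕ Fin n} (hij : i ≠ j) {d : ZMod 2} (c : K) (a : 𝒜 d),
      X hij (c • a) = c • X hij a)
    (hmul : ∀ {i j k : Fin m ⊕ Fin n} (hij : i ≠ j) (hjk : j ≠ k) (hik : i ≠ k) {d e : ZMod 2}
      (a : 𝒜 d) (b : 𝒜 e), bracket (K := K) (X hij a) (X hjk b) = X hik (homMul 𝒜 a b))
    (hcomm : ∀ {i j k l : Fin m ⊕ Fin n} (hij : i ≠ j) (hkl : k ≠ l) (_ : j ≠ k) (_ : i ≠ l)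
      {d e : ZMod 2} (a : 𝒜 d) (b : 𝒜 e), bracket (K := K) (X hij a) (X hkl b) = 0) :
    ∃ θ : Hom K (st m n 𝒜) M, ∀ (i j : Fin m ⊕ Fin n) (hij : i ≠ j) (d : ZMod 2) (a : 𝒜 d),
      θ.toLinearMap (stF m n 𝒜 hij a) = X hij a := by
  obtain ⟨θ, hθ⟩ := exists_presented_lift (StGen.degree m n 𝒜) {t | StRelator m n 𝒜 t}
    (fun _ h => StRelator.homogeneous m n 𝒜 h) (fun g : StGen m n 𝒜 => X g.ne g.a)
    (fun g => hX g.ne g.a) (by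
      intro φ hφ hof t ht
      have hF : ∀ {i j : Fin m ⊕ Fin n} (hij : i ≠ j) {d : ZMod 2} (a : 𝒜 d),
          φ (freeF m n 𝒜 hij a) = X hij a := fun hij _ a => hof ⟨_, _, hij, _, a⟩
      cases ht with
      | add hij a b => simp [hF, hadd]
      | smul hij c a => simp [hF, hsmul]
      | mul hij hjk hik a b =>
        rw [map_sub, hφ, hF, hF, hF, hmul hij hjk hik]
        exact sub_self _
      | comm hij hkl hjk hil a b => rw [hφ, hF, hF, hcomm hij hkl hjk hil])
  exact ⟨θ, fun i j hij d a => hθ ⟨i, j, hij, d, a⟩⟩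

theorem exists_st_to_sl : ∃ u : Hom K (st m n 𝒜) (sl m n 𝒜),
    ∀ (i j : Fin m ⊕ Fin n) (hij : i ≠ j) (d : ZMod 2) (a : 𝒜 d),
      u.toLinearMap (stF m n 𝒜 hij a) = slE m n 𝒜 hij a :=
  exists_st_lift m n 𝒜 (fun hij _ a => slE m n 𝒜 hij a) (slE_mem m n 𝒜) (slE_add m n 𝒜)
    (slE_smul m n 𝒜) (bracket_slE_mul m n 𝒜) (bracket_slE_comm m n 𝒜)

variable {m n}

/-- Among at least five indices, one avoids any four given ones. -/
theorem exists_index_ne (hmn : 5 ≤ m + n) (i j k l : Fin m ⊕ Fin n) :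
    ∃ p : Fin m ⊕ Fin n, p ≠ i ∧ p ≠ j ∧ p ≠ k ∧ p ≠ l := by
  obtain ⟨p, hp⟩ : ∃ p, p ∉ ({i, j, k, l} : Finset (Fin m ⊕ Fin n)) := by
    by_contra! h
    have h1 := Finset.card_le_card (fun x _ => h x : Finset.univ ⊆ _)
    have h2 := Finset.card_le_four (a := i) (b := j) (c := k) (d := l)
    simp only [Finset.card_univ, Fintype.card_sum, Fintype.card_fin] at h1
    omega
  exact ⟨p, by simpa using hp⟩

theorem stF_congr {i j : Fin m ⊕ Fin n} (hij : i ≠ j) {d e : ZMod 2} {a : 𝒜 d} {b : 𝒜 e}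
    (hde : d = e) (h : (a : A) = b) : stF m n 𝒜 hij a = stF m n 𝒜 hij b := by
  subst hde
  rw [Subtype.ext h]

theorem stF_eq_bracket {i j p : Fin m ⊕ Fin n} (hij : i ≠ j) (hip : i ≠ p) (hpj : p ≠ j)
    {d : ZMod 2} (a : 𝒜 d) :
    stF m n 𝒜 hij a =
      bracket (K := K) (stF m n 𝒜 hip a) (stF m n 𝒜 hpj (evenOne 𝒜)) := by
  rw [bracket_stF_mul m n 𝒜 hip hpj hij]
  exact stF_congr 𝒜 hij (add_zero d).symm (mul_one (a : A)).symm

theorem st_isPerfect (hmn : 5 ≤ m + n) : IsPerfect K (st m n 𝒜) := by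
  refine st_eq_top m n 𝒜 (fun i j hij d a => ?_)
    fun x _ y _ => Submodule.subset_span ⟨x, y, rfl⟩
  obtain ⟨p, hpi, hpj, -⟩ := exists_index_ne hmn i j i i
  exact Submodule.subset_span ⟨_, _, stF_eq_bracket 𝒜 hij hpi.symm hpj a⟩

end Steinberg

end

section

variable {K A : Type*} [CommRing K] [Ring A] [Algebra K A] {m n : ℕ}
  (𝒜 : ZMod 2 → Submodule K A) [GradedAlgebra 𝒜]

/-! ### The root decomposition of the Steinberg Lie superalgebra -/

section RootDecomposition

/-- The root submodule `F_{ij}(A)` of `st(m, n, A)`. -/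
noncomputable def rootSpace {i j : Fin m ⊕ Fin n} (hij : i ≠ j) : Submodule K (st m n 𝒜) :=
  Submodule.span K {x | ∃ (d : ZMod 2) (a : 𝒜 d), x = stF m n 𝒜 hij a}

/-- The brackets `[F_{kl}(a), F_{lk}(b)]` of homogeneous elements of opposite root submodules. -/
def cartanGenerators (m n : ℕ) (𝒜 : ZMod 2 → Submodule K A) [GradedAlgebra 𝒜] :
    Set (st m n 𝒜) :=
  {x | ∃ (k l : Fin m ⊕ Fin n) (hkl : k ≠ l) (d e : ZMod 2) (a : 𝒜 d) (b : 𝒜 e),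
    x = bracket (K := K) (stF m n 𝒜 hkl a) (stF m n 𝒜 hkl.symm b)}

/-- The submodule of `st(m, n, A)` spanned by the brackets of opposite root submodules; it plays
the role of a Cartan subalgebra. -/
noncomputable def cartan (m n : ℕ) (𝒜 : ZMod 2 → Submodule K A) [GradedAlgebra 𝒜] :
    Submodule K (st m n 𝒜) :=
  Submodule.span K (cartanGenerators m n 𝒜)

variable {𝒜}

theorem stF_mem_rootSpace {i j : Fin m ⊕ Fin n} (hij : i ≠ j) {d : ZMod 2} (a : 𝒜 d) :
    stF m n 𝒜 hij a ∈ rootSpace 𝒜 hij :=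
  Submodule.subset_span ⟨d, a, rfl⟩

theorem bracket_mem_of_span {S T : Set (st m n 𝒜)} {N : Submodule K (st m n 𝒜)}
    (h : ∀ s ∈ S, ∀ t ∈ T, bracket (K := K) s t ∈ N) {x y : st m n 𝒜}
    (hx : x ∈ Submodule.span K S) (hy : y ∈ Submodule.span K T) : bracket (K := K) x y ∈ N := by
  have hle : Submodule.map₂ (bracket (K := K)) (Submodule.span K S) (Submodule.span K T) ≤ N := by
    rw [Submodule.map₂_span_span, Submodule.span_le]
    rintro _ ⟨s, hs, t, ht, rfl⟩
    exact h s hs t ht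
  exact hle (Submodule.apply_mem_map₂ _ hx hy)

theorem bracket_rootSpace_mul {i j k : Fin m ⊕ Fin n} (hij : i ≠ j) (hjk : j ≠ k) (hik : i ≠ k)
    {x y : st m n 𝒜} (hx : x ∈ rootSpace 𝒜 hij) (hy : y ∈ rootSpace 𝒜 hjk) :
    bracket (K := K) x y ∈ rootSpace 𝒜 hik := by
  refine bracket_mem_of_span ?_ hx hy
  rintro _ ⟨d, a, rfl⟩ _ ⟨e, b, rfl⟩
  rw [bracket_stF_mul m n 𝒜 hij hjk hik]
  exact stF_mem_rootSpace hik _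

theorem bracket_rootSpace_mul' {i j k : Fin m ⊕ Fin n} (hij : i ≠ j) (hjk : j ≠ k) (hik : i ≠ k)
    {x y : st m n 𝒜} (hx : x ∈ rootSpace 𝒜 hij) (hy : y ∈ rootSpace 𝒜 hjk) :
    bracket (K := K) y x ∈ rootSpace 𝒜 hik := by
  refine bracket_mem_of_span ?_ hy hx
  rintro _ ⟨d, a, rfl⟩ _ ⟨e, b, rfl⟩
  exact bracket_mem_symm (stF_mem m n 𝒜 hij b) (stF_mem m n 𝒜 hjk a)
    (bracket_rootSpace_mul hij hjk hik (stF_mem_rootSpace hij b) (stF_mem_rootSpace hjk a))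

theorem bracket_rootSpace_opposite {k l : Fin m ⊕ Fin n} (hkl : k ≠ l) (hlk : l ≠ k)
    {x y : st m n 𝒜} (hx : x ∈ rootSpace 𝒜 hkl) (hy : y ∈ rootSpace 𝒜 hlk) :
    bracket (K := K) x y ∈ cartan m n 𝒜 := by
  refine bracket_mem_of_span ?_ hx hy
  rintro _ ⟨d, a, rfl⟩ _ ⟨e, b, rfl⟩
  exact Submodule.subset_span ⟨k, l, hkl, d, e, a, b, rfl⟩

/-- A bracket `[F_{kl}(a), F_{lk}(b)]` normalizes `F_{ij}(A)` when `{k, l} ≠ {i, j}`: by the Jacobi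
identity it acts through `[F_{lk}(b), F_{ij}(c)]` and `[F_{kl}(a), F_{ij}(c)]`, where the Steinberg
relations apply. -/
theorem bracket_opposite_rootSpace_of_ne {i j k l : Fin m ⊕ Fin n} (hij : i ≠ j) (hkl : k ≠ l)
    (h1 : ¬(k = i ∧ l = j)) (h2 : ¬(k = j ∧ l = i)) {d e : ZMod 2} (a : 𝒜 d) (b : 𝒜 e)
    {z : st m n 𝒜} (hz : z ∈ rootSpace 𝒜 hij) :
    bracket (K := K) (bracket (K := K) (stF m n 𝒜 hkl a) (stF m n 𝒜 hkl.symm b)) z ∈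
      rootSpace 𝒜 hij := by
  revert z
  change rootSpace 𝒜 hij ≤ (rootSpace 𝒜 hij).comap _
  rw [rootSpace, Submodule.span_le]
  rintro _ ⟨f, c, rfl⟩
  change _ ∈ rootSpace 𝒜 hij
  rw [bracket_bracket (stF_mem m n 𝒜 hkl a) (stF_mem m n 𝒜 hkl.symm b) (stF_mem m n 𝒜 hij c)]
  have ma := stF_mem_rootSpace (𝒜 := 𝒜) hkl a
  have mb := stF_mem_rootSpace (𝒜 := 𝒜) hkl.symm b
  have mc := stF_mem_rootSpace (𝒜 := 𝒜) hij c
  refine sub_mem ?_ (zsmul_mem ?_ _)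
  · by_cases hki : k = i
    · subst hki
      have hlj : l ≠ j := fun h => h1 ⟨rfl, h⟩
      exact bracket_rootSpace_mul hkl hlj hij ma (bracket_rootSpace_mul hkl.symm hij hlj mb mc)
    · by_cases hlj : l = j
      · subst hlj
        exact bracket_rootSpace_mul' (Ne.symm hki) hkl hij
          (bracket_rootSpace_mul' hij hkl.symm (Ne.symm hki) mc mb) ma
      · rw [bracket_stF_comm m n 𝒜 hkl.symm hij hki hlj, map_zero]
        exact zero_mem _
  · by_cases hli : l = i
    · subst hli
      have hkj : k ≠ j := fun h => h2 ⟨h, rfl⟩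
      exact bracket_rootSpace_mul hkl.symm hkj hij mb (bracket_rootSpace_mul hkl hij hkj ma mc)
    · by_cases hkj : k = j
      · subst hkj
        exact bracket_rootSpace_mul' (Ne.symm hli) hkl.symm hij
          (bracket_rootSpace_mul' hij hkl (Ne.symm hli) mc ma) mb
      · rw [bracket_stF_comm m n 𝒜 hkl hij hli hkj, map_zero]
        exact zero_mem _

theorem cartanGenerators_homogeneous {h : st m n 𝒜} (hh : h ∈ cartanGenerators m n 𝒜) :
    ∃ i, h ∈ part (K := K) i := by
  obtain ⟨k, l, hkl, d, e, a, b, rfl⟩ := hh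
  exact ⟨_, bracket_mem (stF_mem m n 𝒜 hkl a) (stF_mem m n 𝒜 hkl.symm b)⟩

/-- The Cartan part normalizes every root submodule. -/
theorem bracket_cartan_rootSpace (hmn : 5 ≤ m + n) {i j : Fin m ⊕ Fin n} (hij : i ≠ j)
    {h z : st m n 𝒜} (hh : h ∈ cartan m n 𝒜) (hz : z ∈ rootSpace 𝒜 hij) :
    bracket (K := K) h z ∈ rootSpace 𝒜 hij := by
  refine bracket_mem_of_span ?_ hh hz
  rintro _ ⟨k, l, hkl, d, e, a, b, rfl⟩ _ ⟨f, c, rfl⟩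
  by_cases h12 : (k = i ∧ l = j) ∨ (k = j ∧ l = i)
  · -- Here the Jacobi identity would meet brackets of opposite root submodules again, so
    -- `F_{ij}(c)` is first written as the bracket of elements of two other root submodules.
    obtain ⟨p, hpi, hpj, -⟩ := exists_index_ne hmn i j i i
    have hip := stF_mem_rootSpace (𝒜 := 𝒜) hpi.symm c
    have hpj' := stF_mem_rootSpace (𝒜 := 𝒜) hpj (evenOne 𝒜)
    obtain ⟨q, hq⟩ := cartanGenerators_homogeneous ⟨k, l, hkl, d, e, a, b, rfl⟩
    rw [stF_eq_bracket 𝒜 hij hpi.symm hpj, bracket_jacobi hq (stF_mem m n 𝒜 hpi.symm c)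
      (stF_mem m n 𝒜 hpj (evenOne 𝒜))]
    refine add_mem (bracket_rootSpace_mul hpi.symm hpj hij
      (bracket_opposite_rootSpace_of_ne hpi.symm hkl ?_ ?_ a b hip) hpj')
      (zsmul_mem (bracket_rootSpace_mul hpi.symm hpj hij hip
      (bracket_opposite_rootSpace_of_ne hpj hkl ?_ ?_ a b hpj')) _)
    all_goals grind
  · rw [not_or] at h12
    exact bracket_opposite_rootSpace_of_ne hij hkl h12.1 h12.2 a b (stF_mem_rootSpace hij c)

/-- The map `F_{ij} : A → st(m, n, A)`, extended linearly to inhomogeneous elements, and by zero to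
`i = j`. -/
noncomputable def rootMap (m n : ℕ) (𝒜 : ZMod 2 → Submodule K A) [GradedAlgebra 𝒜]
    (i j : Fin m ⊕ Fin n) : A →ₗ[K] st m n 𝒜 :=
  if hij : i ≠ j then
    DirectSum.toModule K (ZMod 2) (st m n 𝒜)
      (fun _ => { toFun := stF m n 𝒜 hij
                  map_add' := stF_add m n 𝒜 hij
                  map_smul' := stF_smul m n 𝒜 hij }) ∘ₗ
      (DirectSum.decomposeLinearEquiv 𝒜).toLinearMap
  else 0

theorem rootMap_coe {i j : Fin m ⊕ Fin n} (hij : i ≠ j) {d : ZMod 2} (a : 𝒜 d) :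
    rootMap m n 𝒜 i j (a : A) = stF m n 𝒜 hij a := by
  rw [rootMap, dif_pos hij]
  simp only [LinearMap.comp_apply, LinearEquiv.coe_coe, DirectSum.decomposeLinearEquiv_apply,
    DirectSum.decompose_coe]
  exact DirectSum.toModule_lof (M := fun i => 𝒜 i) K d a

theorem rootSpace_le_range {i j : Fin m ⊕ Fin n} (hij : i ≠ j) :
    rootSpace 𝒜 hij ≤ LinearMap.range (rootMap m n 𝒜 i j) := by
  rw [rootSpace, Submodule.span_le]
  rintro _ ⟨d, a, rfl⟩
  exact ⟨a, rootMap_coe hij a⟩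

/-- The sum `∑ F_{ij}(M_{ij})` over the off-diagonal entries of a matrix `M`. -/
noncomputable def rootSum (m n : ℕ) (𝒜 : ZMod 2 → Submodule K A) [GradedAlgebra 𝒜] :
    Matrix (Fin m ⊕ Fin n) (Fin m ⊕ Fin n) A →ₗ[K] st m n 𝒜 :=
  ∑ i, ∑ j, rootMap m n 𝒜 i j ∘ₗ Matrix.entryLinearMap K A i j

theorem rootSum_apply (M : Matrix (Fin m ⊕ Fin n) (Fin m ⊕ Fin n) A) :
    rootSum m n 𝒜 M = ∑ i, ∑ j, rootMap m n 𝒜 i j (M i j) := by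
  simp [rootSum, LinearMap.sum_apply]

theorem rootSum_single (i j : Fin m ⊕ Fin n) (a : A) :
    rootSum m n 𝒜 (Matrix.single i j a) = rootMap m n 𝒜 i j a := by
  rw [rootSum_apply, Finset.sum_eq_single i, Finset.sum_eq_single j]
  · simp
  · intro l _ hl
    rw [Matrix.single_apply_of_ne _ _ _ _ _ (fun h => hl h.2.symm), map_zero]
  · simp
  · intro k _ hk
    refine Finset.sum_eq_zero fun l _ => ?_
    rw [Matrix.single_apply_of_ne _ _ _ _ _ (fun h => hk h.1.symm), map_zero]
  · simp

theorem rootSpace_le_range_rootSum {i j : Fin m ⊕ Fin n} (hij : i ≠ j) :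
    rootSpace 𝒜 hij ≤ LinearMap.range (rootSum m n 𝒜) := fun x hx => by
  obtain ⟨a, rfl⟩ := rootSpace_le_range hij hx
  exact ⟨_, rootSum_single i j a⟩

/-- The root decomposition: `st(m, n, A)` is the sum of its root submodules and the Cartan
part. -/
theorem rootSum_sup_cartan (hmn : 5 ≤ m + n) :
    LinearMap.range (rootSum m n 𝒜) ⊔ cartan m n 𝒜 = ⊤ := by
  set N := LinearMap.range (rootSum m n 𝒜) ⊔ cartan m n 𝒜
  let F : Set (st m n 𝒜) := {x | ∃ (i j : Fin m ⊕ Fin n) (hij : i ≠ j) (d : ZMod 2) (a : 𝒜 d),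
    x = stF m n 𝒜 hij a}
  have hroot : ∀ {i j : Fin m ⊕ Fin n} (hij : i ≠ j), rootSpace 𝒜 hij ≤ N :=
    fun hij => (rootSpace_le_range_rootSum hij).trans le_sup_left
  have hS : Submodule.span K (F ∪ cartanGenerators m n 𝒜) = ⊤ := by
    have hroot' : ∀ {i j : Fin m ⊕ Fin n} (hij : i ≠ j),
        rootSpace 𝒜 hij ≤ Submodule.span K (F ∪ cartanGenerators m n 𝒜) := fun hij =>
      Submodule.span_mono fun x ⟨d, a, e⟩ => .inl ⟨_, _, hij, d, a, e⟩
    have hcartan' : cartan m n 𝒜 ≤ Submodule.span K (F ∪ cartanGenerators m n 𝒜) :=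
      Submodule.span_mono Set.subset_union_right
    refine st_eq_top m n 𝒜
      (fun i j hij d a => hroot' hij (stF_mem_rootSpace hij a))
      fun x hx y hy => bracket_mem_of_span ?_ hx hy
    rintro s (⟨i, j, hij, d, a, rfl⟩ | hs) t (⟨k, l, hkl, e, b, rfl⟩ | ht)
    · have ma := stF_mem_rootSpace (𝒜 := 𝒜) hij a
      have mb := stF_mem_rootSpace (𝒜 := 𝒜) hkl b
      by_cases hjk : j = k
      · subst hjk
        by_cases hil : i = l
        · subst hil
          exact hcartan' (bracket_rootSpace_opposite hij hkl ma mb)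
        · exact hroot' hil (bracket_rootSpace_mul hij hkl hil ma mb)
      · by_cases hil : i = l
        · subst hil
          exact hroot' (Ne.symm hjk) (bracket_rootSpace_mul' hkl hij (Ne.symm hjk) mb ma)
        · rw [bracket_stF_comm m n 𝒜 hij hkl hjk hil]
          exact zero_mem _
    · obtain ⟨q, hq⟩ := cartanGenerators_homogeneous ht
      exact bracket_mem_symm hq (stF_mem m n 𝒜 hij a) (hroot' hij
        (bracket_cartan_rootSpace hmn hij (Submodule.subset_span ht) (stF_mem_rootSpace hij a)))
    · exact hroot' hkl
        (bracket_cartan_rootSpace hmn hkl (Submodule.subset_span hs) (stF_mem_rootSpace hkl b))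
    · obtain ⟨k, l, hkl, d, e, a, b, rfl⟩ := ht
      obtain ⟨q, hq⟩ := cartanGenerators_homogeneous hs
      have ma := stF_mem_rootSpace (𝒜 := 𝒜) hkl a
      have mb := stF_mem_rootSpace (𝒜 := 𝒜) hkl.symm b
      have hs' : s ∈ cartan m n 𝒜 := Submodule.subset_span hs
      rw [bracket_jacobi hq (stF_mem m n 𝒜 hkl a) (stF_mem m n 𝒜 hkl.symm b)]
      exact hcartan' (add_mem
        (bracket_rootSpace_opposite hkl hkl.symm (bracket_cartan_rootSpace hmn hkl hs' ma) mb)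
        (zsmul_mem (bracket_rootSpace_opposite hkl hkl.symm ma
          (bracket_cartan_rootSpace hmn hkl.symm hs' mb)) _))
  rw [eq_top_iff, ← hS, Submodule.span_le]
  rintro x (⟨i, j, hij, d, a, rfl⟩ | hx)
  · exact hroot hij (stF_mem_rootSpace hij a)
  · exact le_sup_right (a := LinearMap.range (rootSum m n 𝒜)) (Submodule.subset_span hx)

end RootDecomposition

/-! ### Centrality of the kernel -/

section Kernel

variable {𝒜} {u : Hom K (st m n 𝒜) (sl m n 𝒜)}
  (hu : ∀ (i j : Fin m ⊕ Fin n) (hij : i ≠ j) (d : ZMod 2) (a : 𝒜 d),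
    u.toLinearMap (stF m n 𝒜 hij a) = slE m n 𝒜 hij a)

include hu

theorem map_rootMap {i j : Fin m ⊕ Fin n} (hij : i ≠ j) (a : A) :
    (u.toLinearMap (rootMap m n 𝒜 i j a) : gl m n 𝒜) = glE m n 𝒜 i j a := by
  induction a using DirectSum.Decomposition.inductionOn 𝒜 with
  | zero => rw [map_zero, map_zero]; exact (Matrix.single_zero i j).symm
  | homogeneous a => rw [rootMap_coe hij, hu]; rfl
  | add a b ha hb =>
    rw [map_add, map_add, Submodule.coe_add, ha, hb]
    exact (Matrix.single_add i j a b).symm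

theorem map_cartan_apply_of_ne {h : st m n 𝒜} (hh : h ∈ cartan m n 𝒜) {i j : Fin m ⊕ Fin n}
    (hij : i ≠ j) :
    ((u.toLinearMap h : gl m n 𝒜) : Matrix (Fin m ⊕ Fin n) (Fin m ⊕ Fin n) A) i j = 0 := by
  let entry : st m n 𝒜 →ₗ[K] A :=
    Matrix.entryLinearMap K A i j ∘ₗ (sl m n 𝒜).subtype ∘ₗ u.toLinearMap
  have hle : cartan m n 𝒜 ≤ LinearMap.ker entry := by
    rw [cartan, Submodule.span_le]
    rintro _ ⟨k, l, hkl, d, e, a, b, rfl⟩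
    have h := u.map_bracket (stF m n 𝒜 hkl a) (stF m n 𝒜 hkl.symm b)
    rw [hu, hu] at h
    have h' := congrArg Subtype.val h
    exact (congrFun (congrFun h' i) j).trans (bracket_glE_apply_of_ne m n 𝒜 a b hij)
  exact hle hh

theorem map_rootSum_apply_of_ne (M : Matrix (Fin m ⊕ Fin n) (Fin m ⊕ Fin n) A)
    {i j : Fin m ⊕ Fin n} (hij : i ≠ j) :
    ((u.toLinearMap (rootSum m n 𝒜 M) : gl m n 𝒜) :
      Matrix (Fin m ⊕ Fin n) (Fin m ⊕ Fin n) A) i j = M i j := by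
  let entry : st m n 𝒜 →ₗ[K] A :=
    Matrix.entryLinearMap K A i j ∘ₗ (sl m n 𝒜).subtype ∘ₗ u.toLinearMap
  have hentry : ∀ k l a, entry (rootMap m n 𝒜 k l a) = if k = i ∧ l = j then a else 0 := by
    intro k l a
    by_cases hkl : k = l
    · have hne : ¬(k = i ∧ l = j) := by rintro ⟨rfl, rfl⟩; exact hij hkl
      rw [rootMap, dif_neg (not_not_intro hkl), LinearMap.zero_apply, map_zero, if_neg hne]
    · exact (congrFun (congrFun (map_rootMap hu hkl a) i) j).trans (Matrix.single_apply k l a i j)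
  change entry (rootSum m n 𝒜 M) = M i j
  simp only [rootSum_apply, map_sum, hentry]
  rw [Finset.sum_eq_single i, Finset.sum_eq_single j] <;> simp +contextual

/-- The kernel of `st(m, n, A) → sl(m, n, A)` lies in the Cartan part: the off-diagonal entries of
the image of `x` are the root components of `x`. -/
theorem ker_le_cartan (hmn : 5 ≤ m + n) : LinearMap.ker u.toLinearMap ≤ cartan m n 𝒜 := by
  intro x hx
  rw [LinearMap.mem_ker] at hx
  obtain ⟨_, ⟨M, rfl⟩, h, hh, rfl⟩ := Submodule.mem_sup.1
    ((rootSum_sup_cartan (𝒜 := 𝒜) hmn).symm ▸ Submodule.mem_top : x ∈ _)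
  have hM : ∀ i j, i ≠ j → M i j = 0 := by
    intro i j hij
    rw [map_add] at hx
    have h0 := congrFun (congrFun (congrArg Subtype.val hx) i) j
    have h1 : ((u.toLinearMap (rootSum m n 𝒜 M) : gl m n 𝒜) :
          Matrix (Fin m ⊕ Fin n) (Fin m ⊕ Fin n) A) i j +
        ((u.toLinearMap h : gl m n 𝒜) : Matrix (Fin m ⊕ Fin n) (Fin m ⊕ Fin n) A) i j = 0 := h0
    rwa [map_rootSum_apply_of_ne hu M hij, map_cartan_apply_of_ne hu hh hij, add_zero] at h1
  have h0 : rootSum m n 𝒜 M = 0 := by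
    rw [rootSum_apply]
    refine Finset.sum_eq_zero fun i _ => Finset.sum_eq_zero fun j _ => ?_
    by_cases hij : i = j
    · rw [rootMap, dif_neg (not_not_intro hij), LinearMap.zero_apply]
    · rw [hM i j hij, map_zero]
  rw [h0, zero_add]
  exact hh

theorem map_rootSpace_injective {i j : Fin m ⊕ Fin n} (hij : i ≠ j) {x : st m n 𝒜}
    (hx : x ∈ rootSpace 𝒜 hij) (h : u.toLinearMap x = 0) : x = 0 := by
  obtain ⟨a, rfl⟩ := rootSpace_le_range hij hx
  have h1 : Matrix.single i j a = 0 :=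
    (map_rootMap hu hij a).symm.trans (congrArg Subtype.val h)
  have h2 := congrFun (congrFun h1 i) j
  rw [Matrix.single_apply_same] at h2
  rw [h2, Matrix.zero_apply, map_zero]

/-- The kernel of `st(m, n, A) → sl(m, n, A)` is central: it normalizes the root submodules, on
which the map is injective. -/
theorem bracket_eq_zero_of_mem_ker (hmn : 5 ≤ m + n) {c : st m n 𝒜} (hc : u.toLinearMap c = 0)
    (x : st m n 𝒜) : bracket (K := K) c x = 0 := by
  have key : ∀ {i : ZMod 2} {c : st m n 𝒜}, c ∈ part (K := K) i → u.toLinearMap c = 0 →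
      LinearMap.ker (bracket (K := K) c) = ⊤ := by
    intro i c hci hc
    refine st_eq_top m n 𝒜 (fun i j hij d a => ?_) fun x hx y hy =>
      bracket_bracket_eq_zero hci hx hy
    refine map_rootSpace_injective hu hij
      (bracket_cartan_rootSpace hmn hij (ker_le_cartan hu hmn hc) (stF_mem_rootSpace hij a)) ?_
    rw [u.map_bracket, hc, map_zero, LinearMap.zero_apply]
  obtain ⟨c0, h0, c1, h1, rfl⟩ := exists_add (isCompl_part (K := K)) c
  rw [map_add] at hc
  have hc' := eq_zero_of_add (isCompl_part (K := K)) (u.map_part _ _ h0) (u.map_part _ _ h1) hc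
  have e0 : bracket (K := K) c0 x = 0 :=
    LinearMap.mem_ker.1 (key h0 hc'.1 ▸ Submodule.mem_top : x ∈ _)
  have e1 : bracket (K := K) c1 x = 0 :=
    LinearMap.mem_ker.1 (key h1 hc'.2 ▸ Submodule.mem_top : x ∈ _)
  rw [map_add, LinearMap.add_apply, e0, e1, add_zero]

theorem isCentralExtension_st (hmn : 5 ≤ m + n) : IsCentralExtension K u :=
  ⟨surjective_of_slE_mem_range m n 𝒜 u fun i j hij d a => ⟨_, hu i j hij d a⟩,
    fun _ hc x => bracket_eq_zero_of_mem_ker hu hmn hc x⟩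

end Kernel

end

/-! ### Universality -/

section Universal

variable {K A : Type*} [CommRing K] [Ring A] [Algebra K A] {m n : ℕ}
  {𝒜 : ZMod 2 → Submodule K A} [GradedAlgebra 𝒜]
  {M : Type*} [AddCommGroup M] [Module K M] [LieSuperalgebra K M]
  {f : Hom K M (sl m n 𝒜)} (hf : IsCentralExtension K f)
  {w : sl m n 𝒜 →ₗ[K] sl m n 𝒜 →ₗ[K] M}
  (hw : ∀ x y : M, w (f.toLinearMap x) (f.toLinearMap y) = bracket (K := K) x y)

include hf hw

/-- In a central extension of `sl(m, n, A)`, lifts of `E_{ij}(a)` and `E_{kl}(b)` commute if `j ≠ k`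
and `i ≠ l`: write `E_{kl}(b) = [E_{kp}(b), E_{pl}(1)]` with `p` outside `{i, j, k, l}`. This is
where five indices are needed. -/
theorem lift_bracket_slE_comm (hmn : 5 ≤ m + n) {i j k l : Fin m ⊕ Fin n} (hij : i ≠ j)
    (hkl : k ≠ l) (hjk : j ≠ k) (hil : i ≠ l) {d e : ZMod 2} (a : 𝒜 d) (b : 𝒜 e) :
    w (slE m n 𝒜 hij a) (slE m n 𝒜 hkl b) = 0 := by
  obtain ⟨p, hpi, hpj, hpk, hpl⟩ := exists_index_ne hmn i j k l
  have hb : slE m n 𝒜 hkl b =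
      bracket (K := K) (slE m n 𝒜 hpk.symm b) (slE m n 𝒜 hpl (evenOne 𝒜)) := by
    rw [bracket_slE_mul m n 𝒜 hpk.symm hpl hkl]
    exact slE_congr m n 𝒜 hkl (mul_one (b : A)).symm
  rw [hb, hf.lift_bracket_jacobi hw (slE_mem m n 𝒜 hij a) (slE_mem m n 𝒜 hpk.symm b)
    (slE_mem m n 𝒜 hpl (evenOne 𝒜)), bracket_slE_comm m n 𝒜 hij hpk.symm hjk hpi.symm,
    bracket_slE_comm m n 𝒜 hij hpl hpj.symm hil]
  simp

/-- In the bracket of lifts of `E_{ij}(a)` and `E_{jk}(b)`, the middle index `j` can be changed to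
any `p ≠ j` while `b` is moved to the left factor. -/
theorem lift_bracket_slE_mul_of_ne {i j k p : Fin m ⊕ Fin n} (hij : i ≠ j)
    (hjk : j ≠ k) (hik : i ≠ k) (hip : i ≠ p) (hpk : p ≠ k) (hpj : p ≠ j) {d e : ZMod 2}
    (a : 𝒜 d) (b : 𝒜 e) :
    w (slE m n 𝒜 hij a) (slE m n 𝒜 hjk b) =
      w (slE m n 𝒜 hip (homMul 𝒜 a b)) (slE m n 𝒜 hpk (evenOne 𝒜)) := by
  have hb : slE m n 𝒜 hjk b =
      bracket (K := K) (slE m n 𝒜 hpj.symm b) (slE m n 𝒜 hpk (evenOne 𝒜)) := by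
    rw [bracket_slE_mul m n 𝒜 hpj.symm hpk hjk]
    exact slE_congr m n 𝒜 hjk (mul_one (b : A)).symm
  rw [hb, hf.lift_bracket_jacobi hw (slE_mem m n 𝒜 hij a) (slE_mem m n 𝒜 hpj.symm b)
    (slE_mem m n 𝒜 hpk (evenOne 𝒜)), bracket_slE_mul m n 𝒜 hij hpj.symm hip,
    bracket_slE_comm m n 𝒜 hij hpk hpj.symm hik]
  simp

/-- The bracket of lifts of `E_{ij}(a)` and `E_{jk}(b)` depends only on `i`, `k` and `ab`. -/
theorem lift_bracket_slE_mul (hmn : 5 ≤ m + n) {i j k p : Fin m ⊕ Fin n} (hij : i ≠ j)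
    (hjk : j ≠ k) (hik : i ≠ k) (hip : i ≠ p) (hpk : p ≠ k) {d e : ZMod 2}
    (a : 𝒜 d) (b : 𝒜 e) :
    w (slE m n 𝒜 hij a) (slE m n 𝒜 hjk b) =
      w (slE m n 𝒜 hip (homMul 𝒜 a b)) (slE m n 𝒜 hpk (evenOne 𝒜)) := by
  by_cases hpj : p = j
  · subst hpj
    -- The middle index is moved to `q` and back.
    obtain ⟨q, hqi, hqp, hqk, -⟩ := exists_index_ne hmn i p k k
    rw [lift_bracket_slE_mul_of_ne hf hw hij hjk hik hqi.symm hqk hqp a b,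
      lift_bracket_slE_mul_of_ne hf hw hip hpk hik hqi.symm hqk hqp _ (evenOne 𝒜)]
    exact congrArg (fun t => w t _) (slE_congr m n 𝒜 hqi.symm (mul_one ((a : A) * b)).symm)
  · exact lift_bracket_slE_mul_of_ne hf hw hij hjk hik hip hpk hpj a b

/-- Every central extension of `sl(m, n, A)` receives a homomorphism from `st(m, n, A)`: the
elements `w (E_{ip}(a), E_{pj}(1))`, for any choice of `p`, satisfy the Steinberg relations. -/
theorem exists_st_lift_of_isCentralExtension (hmn : 5 ≤ m + n) :
    ∃ θ : Hom K (st m n 𝒜) M,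
      ∀ (i j : Fin m ⊕ Fin n) (hij : i ≠ j) (d : ZMod 2) (a : 𝒜 d),
        f.toLinearMap (θ.toLinearMap (stF m n 𝒜 hij a)) = slE m n 𝒜 hij a := by
  have hmid : ∀ i j : Fin m ⊕ Fin n, ∃ p, i ≠ p ∧ p ≠ j := fun i j =>
    let ⟨p, hpi, hpj, _⟩ := exists_index_ne hmn i j i i
    ⟨p, hpi.symm, hpj⟩
  choose p hip hpj using hmid
  let X : ∀ {i j : Fin m ⊕ Fin n}, i ≠ j → ∀ {d : ZMod 2}, 𝒜 d → M := fun {i j} _ _ a =>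
    w (slE m n 𝒜 (hip i j) a) (slE m n 𝒜 (hpj i j) (evenOne 𝒜))
  have hfX : ∀ {i j : Fin m ⊕ Fin n} (hij : i ≠ j) {d : ZMod 2} (a : 𝒜 d),
      f.toLinearMap (X hij a) = slE m n 𝒜 hij a := by
    intro i j hij d a
    rw [hf.map_lift_bracket hw, bracket_slE_mul m n 𝒜 (hip i j) (hpj i j) hij]
    exact slE_congr m n 𝒜 hij (mul_one (a : A))
  obtain ⟨θ, hθ⟩ := exists_st_lift m n 𝒜 X
    (fun {i j} hij {d} a => by
      have h := hf.lift_bracket_mem hw (slE_mem m n 𝒜 (hip i j) a)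
        (slE_mem m n 𝒜 (hpj i j) (evenOne 𝒜))
      have h2 : ∀ a b c d : ZMod 2, a + b + d + (b + c + 0) = a + c + d := by decide
      rwa [h2] at h)
    (fun _ _ a b => by simp only [X, slE_add, map_add, LinearMap.add_apply])
    (fun _ _ c a => by simp only [X, slE_smul, map_smul, LinearMap.smul_apply])
    (fun {i j k} hij hjk hik d e a b => by
      rw [← hw, hfX, hfX]
      exact lift_bracket_slE_mul hf hw hmn hij hjk hik (hip i k) (hpj i k) a b)
    (fun hij hkl hjk hil d e a b => by
      rw [← hw, hfX, hfX]
      exact lift_bracket_slE_comm hf hw hmn hij hkl hjk hil a b)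
  exact ⟨θ, fun i j hij d a => by rw [hθ, hfX]⟩

end Universal

theorem isUniversalCentralExtension_st {K : Type u} {A : Type v} [CommRing K] [Ring A]
    [Algebra K A] {m n : ℕ} {𝒜 : ZMod 2 → Submodule K A} [GradedAlgebra 𝒜] (hmn : 5 ≤ m + n)
    {u : Hom K (st m n 𝒜) (sl m n 𝒜)}
    (hu : ∀ (i j : Fin m ⊕ Fin n) (hij : i ≠ j) (d : ZMod 2) (a : 𝒜 d),
      u.toLinearMap (stF m n 𝒜 hij a) = slE m n 𝒜 hij a) :
    IsUniversalCentralExtension.{w} u := by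
  refine ⟨isCentralExtension_st hu hmn, fun M _ _ _ f hf => ?_⟩
  obtain ⟨w, hw⟩ := hf.exists_lift_bracket
  obtain ⟨θ, hθ⟩ := exists_st_lift_of_isCentralExtension hf hw hmn
  have htop : LinearMap.eqLocus (f.toLinearMap ∘ₗ θ.toLinearMap) u.toLinearMap = ⊤ :=
    st_eq_top m n 𝒜 (fun i j hij d a => (hθ i j hij d a).trans (hu i j hij d a).symm)
      fun x hx y hy => by
        rw [LinearMap.mem_eqLocus, LinearMap.comp_apply] at *
        rw [θ.map_bracket, f.map_bracket, u.map_bracket, hx, hy]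
  have hlift : ∀ x, f.toLinearMap (θ.toLinearMap x) = u.toLinearMap x := fun x =>
    LinearMap.mem_eqLocus.1 (htop ▸ Submodule.mem_top : x ∈ _)
  exact ⟨θ, hlift, fun θ' hθ' =>
    hf.hom_ext (st_isPerfect 𝒜 hmn) fun x => (hθ' x).trans (hlift x).symm⟩

end LieSuperalgebra

theorem theorem4p3 {K : Type u} {A : Type v} [CommRing K] [Ring A] [Algebra K A]
    (𝒜 : ZMod 2 → Submodule K A) [GradedAlgebra 𝒜] (m n : ℕ) (hmn : 5 ≤ m + n) :
    IsPerfect K (sl m n 𝒜) ∧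
      (∃! u : Hom K (st m n 𝒜) (sl m n 𝒜),
        ∀ (i j : Fin m ⊕ Fin n) (hij : i ≠ j) (d : ZMod 2) (a : 𝒜 d),
          u.toLinearMap (stF m n 𝒜 hij a) = slE m n 𝒜 hij a) ∧
      ∀ u : Hom K (st m n 𝒜) (sl m n 𝒜),
        (∀ (i j : Fin m ⊕ Fin n) (hij : i ≠ j) (d : ZMod 2) (a : 𝒜 d),
          u.toLinearMap (stF m n 𝒜 hij a) = slE m n 𝒜 hij a) →
        IsUniversalCentralExtension.{w} u := by
  obtain ⟨u, hu⟩ := exists_st_to_sl m n 𝒜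
  refine ⟨(st_isPerfect 𝒜 hmn).of_surjective u (isCentralExtension_st hu hmn).1,
    ⟨u, hu, fun u' hu' => st_hom_ext m n 𝒜 fun i j hij d a => ?_⟩,
    fun _ => isUniversalCentralExtension_st hmn⟩
  rw [hu, hu']
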